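/- Let $D,n,r\ge 1$ be integers and let $\mathbb{F}$ be a field. A *read-once oblivious algebraic branching program (ABP)* of depth $D$ in the variables $x_0,\dots,x_{D-1}$ is a directed graph whose vertices are partitioned into levels $0,\dots,D$; level $0$ consists of one vertex (the source, the only vertex without incoming edges), level $D$ consists of one vertex (the sink, the only vertex without outgoing edges), edges go only from a level $i$ to level $i+1$, and each such edge is labelled by a univariate polynomial in $x_i$ over $\mathbb{F}$. It computes the polynomial $\sum_{p}\prod_{e\in p}\mathrm{label}(e)\in\mathbb{F}[x_0,\dots,x_{D-1}]$, the sum being over all source–sink paths $p$. Its width is the maximum number of vertices of a level, and it has individual degree $<n$ if all labels have degree $<n$. Let $\mathcal{C}$ be the set of polynomials in $\mathbb{F}[x_0,\dots,x_{D-1}]$ computed by such ABPs of depth $D$, width at most $r$ and individual degree $<n$. A set $\mathcal{H}\subseteq\mathbb{F}^D$ is a *hitting set* for $\mathcal{C}$ if for every $f\in\mathcal{C}$: $f=0$ as a polynomial if and only if $f$ vanishes at every point of $\mathcal{H}$. **Theorem (PIT for read-once oblivious ABPs).** If $|\mathbb{F}|\ge(2Dnr^3)^2$, then $\mathcal{C}$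 has a $\mathrm{poly}(D,n,r)$-explicit hitting set of size $\le(2Dn^2r^4)^{\lceil\lg D\rceil+1}$. Here *explicit* means the following. There are one program $P$ of an algebraic random access machine and one polynomial bound $T(D,n,r)=c\,(D+n+r)^k$, all of them independent of $\mathbb{F},D,n,r$, such that for every field $\mathbb{F}$, every enumeration of elements of $\mathbb{F}$ (a sequence without repetitions that lists all of $\mathbb{F}$ if $\mathbb{F}$ is finite, and infinitely many elements if $\mathbb{F}$ is infinite) and all $D,n,r\ge1$ with $|\mathbb{F}|\ge(2Dnr^3)^2$, there is a list of $N\le(2Dn^2r^4)^{\lceil\lg D\rceil+1}$ points of $\mathbb{F}^D$ which form a hitting set for $\mathcal{C}$ and such that $P$, given $(D,n,r,i)$ with $0\le i<N$, outputs the $i$-th point within $T(D,n,r)$ steps. The machine has indirectly addressed memories for natural numbers and for elements of $\mathbb{F}$; field operations, equality tests in $\mathbb{F}$, and addition, truncated subtraction, division with remainder and comparison of natural numbers have unit cost, and producing the $k$-th element of the enumeration takes $k+1$ steps. -/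

import Mathlib

namespace ROPIT

/-! ### Read-once oblivious algebraic branching programs -/

/-- A read-once oblivious algebraic branching program of depth `D` in the variables
`x_0, …, x_{D-1}`: a directed graph whose vertices lie in levels `0, …, D`, with edges only from a
level to the next one. The single vertex of level `0` (the source) is the only vertex without an
incoming edge, the single vertex of level `D` (the sink) is the only vertex without an outgoing
edge. An edge from level `i` to level `i + 1` is labelled by a univariate polynomial, which is read
as a polynomial in `x_i`. -/
structure ROABP (F : Type*) [Field F] (D : ℕ) where
  /-- The number of vertices of each level; the vertices of level `i` are `Fin (size i)`. -/
  size : Fin (D + 1) → ℕ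
  size_source : size 0 = 1
  size_sink : size (Fin.last D) = 1
  /-- The edges from level `i` to level `i + 1`. -/
  edges : (i : Fin D) → Finset (Fin (size i.castSucc) × Fin (size i.succ))
  exists_out : ∀ (i : Fin D) (u : Fin (size i.castSucc)), ∃ v, (u, v) ∈ edges i
  exists_in : ∀ (i : Fin D) (v : Fin (size i.succ)), ∃ u, (u, v) ∈ edges i
  /-- The labels (only the values on the edges matter). -/
  label : (i : Fin D) → Fin (size i.castSucc) → Fin (size i.succ) → Polynomial F

namespace ROABP

variable {F : Type*} [Field F] {D : ℕ}

/-- The directed paths from the source to the sink, each given by its vertex on every level. -/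
def paths (A : ROABP F D) : Finset ((i : Fin (D + 1)) → Fin (A.size i)) :=
  Finset.univ.filter fun v => ∀ i : Fin D, (v i.castSucc, v i.succ) ∈ A.edges i

/-- The polynomial computed by the program: the sum over all source-sink paths of the product of
the labels on the path. -/
noncomputable def poly (A : ROABP F D) : MvPolynomial (Fin D) F :=
  ∑ v ∈ A.paths, ∏ i : Fin D,
    Polynomial.aeval (MvPolynomial.X i : MvPolynomial (Fin D) F)
      (A.label i (v i.castSucc) (v i.succ))

/-- Every level has at most `r` vertices. -/
def WidthLE (A : ROABP F D) (r : ℕ) : Prop := ∀ i, A.size i ≤ r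

/-- Every edge label has degree less than `n`. -/
def DegreeLT (A : ROABP F D) (n : ℕ) : Prop :=
  ∀ (i : Fin D), ∀ p ∈ A.edges i, (A.label i p.1 p.2).degree < (n : WithBot ℕ)

end ROABP

/-- The `D`-variate polynomials computed by a read-once oblivious ABP of depth `D`, width (at most)
`r` and individual degree less than `n`. -/
def roabpClass (F : Type*) [Field F] (D n r : ℕ) : Set (MvPolynomial (Fin D) F) :=
  {f | ∃ A : ROABP F D, A.WidthLE r ∧ A.DegreeLT n ∧ A.poly = f}

/-- `H` is a hitting set for `C`: a polynomial of `C` is zero iff it vanishes on `H`. -/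
def IsHittingSet {F : Type*} [Field F] {D : ℕ} (C : Set (MvPolynomial (Fin D) F))
    (H : Set (Fin D → F)) : Prop :=
  ∀ f ∈ C, f = 0 ↔ ∀ x ∈ H, MvPolynomial.eval x f = 0

/-! ### The model of computation

An algebraic random access machine, programmed by structured (`while`) programs. It has a memory of
natural numbers and a memory of elements of a field `F`, both with indirect addressing. A program is
a finite object that does not depend on `F`. Field operations and equality tests in `F` have unit
cost. Natural numbers can be added, subtracted (truncated), divided with remainder and compared at
unit cost; there is no multiplication, so every step lengthens the binary representation of the
numbers in use by at most one bit, and unit cost is polynomially related to bit cost. -/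

/-- Expressions with values in the natural numbers. -/
inductive NExp : Type
  | const (k : ℕ)
  | load (a : NExp)
  | add (a b : NExp)
  | sub (a b : NExp)
  | div (a b : NExp)
  | mod (a b : NExp)

/-- Expressions with values in the field. -/
inductive FExp : Type
  | zero
  | one
  | load (a : NExp)
  | add (x y : FExp)
  | sub (x y : FExp)
  | mul (x y : FExp)
  | inv (x : FExp)

/-- Tests: comparison of two natural numbers, equality of two field elements. -/
inductive Test : Type
  | le (a b : NExp)
  | eq (x y : FExp)

/-- Programs. `setN a b` writes the number `b` to address `a` of the first memory, `setF a x` writes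
the field element `x` to address `a` of the second memory, and `enum a k` writes there the `k`-th
element of a given enumeration of the field; `loop c P` is "while `c` do `P`". -/
inductive Prog : Type
  | skip
  | setN (a b : NExp)
  | setF (a : NExp) (x : FExp)
  | enum (a k : NExp)
  | seq (P Q : Prog)
  | ite (c : Test) (P Q : Prog)
  | loop (c : Test) (P : Prog)

/-- The contents of the two memories. -/
structure State (F : Type*) where
  nat : ℕ → ℕ
  fld : ℕ → F

namespace NExp

/-- The value of an expression. -/
def eval {F : Type*} (s : State F) : NExp → ℕ
  | const k => k
  | load a => s.nat (a.eval s)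
  | add a b => a.eval s + b.eval s
  | sub a b => a.eval s - b.eval s
  | div a b => a.eval s / b.eval s
  | mod a b => a.eval s % b.eval s

/-- The number of operations in an expression. -/
def cost : NExp → ℕ
  | const _ => 1
  | load a => a.cost + 1
  | add a b => a.cost + b.cost + 1
  | sub a b => a.cost + b.cost + 1
  | div a b => a.cost + b.cost + 1
  | mod a b => a.cost + b.cost + 1

end NExp

namespace FExp

/-- The value of an expression; the inverse of `0` is `0`. -/
def eval {F : Type*} [Field F] (s : State F) : FExp → F
  | zero => 0
  | one => 1
  | load a => s.fld (a.eval s)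
  | add x y => x.eval s + y.eval s
  | sub x y => x.eval s - y.eval s
  | mul x y => x.eval s * y.eval s
  | inv x => (x.eval s)⁻¹

/-- The number of operations in an expression. -/
def cost : FExp → ℕ
  | zero => 1
  | one => 1
  | load a => a.cost + 1
  | add x y => x.cost + y.cost + 1
  | sub x y => x.cost + y.cost + 1
  | mul x y => x.cost + y.cost + 1
  | inv x => x.cost + 1

end FExp

namespace Test

/-- Truth of a test. -/
def Holds {F : Type*} [Field F] (s : State F) : Test → Prop
  | le a b => a.eval s ≤ b.eval s
  | eq x y => x.eval s = y.eval s

/-- The number of operations in a test. -/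
def cost : Test → ℕ
  | le a b => a.cost + b.cost + 1
  | eq x y => x.cost + y.cost + 1

end Test

/-- `Exec e P s t s'`: started in the state `s`, the program `P` halts after `t` steps in the state
`s'`, where `e` is the enumeration of the field. Producing the `k`-th element of the enumeration
takes `k + 1` steps (besides the evaluation of the operands). -/
inductive Exec {F : Type*} [Field F] (e : ℕ → F) : Prog → State F → ℕ → State F → Prop
  | skip (s : State F) : Exec e Prog.skip s 1 s
  | setN (a b : NExp) (s : State F) :
      Exec e (Prog.setN a b) s (a.cost + b.cost + 1)
        { s with nat := Function.update s.nat (a.eval s) (b.eval s) }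
  | setF (a : NExp) (x : FExp) (s : State F) :
      Exec e (Prog.setF a x) s (a.cost + x.cost + 1)
        { s with fld := Function.update s.fld (a.eval s) (x.eval s) }
  | enum (a k : NExp) (s : State F) :
      Exec e (Prog.enum a k) s (a.cost + k.cost + (k.eval s + 1))
        { s with fld := Function.update s.fld (a.eval s) (e (k.eval s)) }
  | seq {P Q : Prog} {s s' s'' : State F} {t t' : ℕ} :
      Exec e P s t s' → Exec e Q s' t' s'' → Exec e (Prog.seq P Q) s (t + t') s''
  | ite_true {c : Test} {P Q : Prog} {s s' : State F} {t : ℕ} :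
      c.Holds s → Exec e P s t s' → Exec e (Prog.ite c P Q) s (c.cost + t) s'
  | ite_false {c : Test} {P Q : Prog} {s s' : State F} {t : ℕ} :
      ¬ c.Holds s → Exec e Q s t s' → Exec e (Prog.ite c P Q) s (c.cost + t) s'
  | loop_true {c : Test} {P : Prog} {s s' s'' : State F} {t t' : ℕ} :
      c.Holds s → Exec e P s t s' → Exec e (Prog.loop c P) s' t' s'' →
        Exec e (Prog.loop c P) s (c.cost + t + t') s''
  | loop_false {c : Test} {P : Prog} {s : State F} :
      ¬ c.Holds s → Exec e (Prog.loop c P) s c.cost s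

/-- The initial state on the input `D, n, r, i`: these four numbers stand at the addresses
`0, 1, 2, 3` of the first memory, and everything else is zero. -/
def input (F : Type*) [Field F] (D n r i : ℕ) : State F where
  nat := fun a => [D, n, r, i].getD a 0
  fld := fun _ => 0

/-- On the input `D, n, r, i` the program `P` halts after at most `T` steps with the vector `x` at
the addresses `0, …, D - 1` of the field memory. -/
def ComputesPoint {F : Type*} [Field F] (e : ℕ → F) (P : Prog) (D n r i T : ℕ) (x : Fin D → F) :
    Prop :=
  ∃ (t : ℕ) (s : State F), t ≤ T ∧ Exec e P (input F D n r i) t s ∧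
    ∀ j : Fin D, s.fld (j : ℕ) = x j

/-- `e` enumerates field elements without repetition: all of `F` by the indices below `|F|` if `F`
is finite, infinitely many distinct elements if `F` is infinite. -/
def IsEnumeration {F : Type*} (e : ℕ → F) : Prop :=
  Set.InjOn e {k | (k : ℕ∞) < ENat.card F}

end ROPIT

namespace ROPIT

/-! Over an extension field E, a program of width r is a product of D univariate polynomial maps
into the r × r matrices, padded with identities to 2^d factors, d = ⌈lg D⌉, followed by the linear
functional "sum of all entries". Let R = r² be the dimension of the matrix algebra. It suffices to
find one curve, with coordinates of degree at most R², such that the values of the product along the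
curve span all its values at independent arguments: a functional that is nonzero somewhere is then
nonzero on the curve.

The curve is built by merging adjacent blocks of factors. Suppose that both halves of a block have
such curves, along which their products are f(u) and g(v). By `exists_polynomial_merge`, for all but
finitely many α the R² products f(α w^l) g(α w^(l+q)), l, q < R, span every f(u) g(v). Two facts
carry this. The products a_i b_j of the coefficients of f and g lie in the span of the coefficients
of the R univariate restrictions f(t) g(w^q t) (`mul_mem_span_antidiagonal`), and the coefficients
of each restriction are spanned by its R samples at t = α w^l (`exists_polynomial_condenser`).
Interpolating the sample points at powers of w gives a curve for the whole block, again of degree at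
most R²: the degree does not grow with the level. One α serves all blocks of a level, so d seeds
suffice (`exists_seeds_span_curve`).

It remains to make the choices explicit. In each of the d seeds and in the parameter of the curve
separately, the functional has degree at most 2^d (n - 1) R² < L = 2 D n r⁴, so these d + 1
quantities can be moved one after the other into {1, w, …, w^(L-1)} (`exists_powers_block_ne_zero`).
Generic elements are needed only in the algebraic closure; the resulting L^(d+1) points lie over F.
A suitable w is found by search among the first L² + 1 listed elements (`exists_hasOrderGE`), and a
point is evaluated by nested interpolation loops in O(L^5) steps. -/

open Finset in
/-- `g` is a polynomial map of degree at most `m` from the field `E` to an `E`-module. -/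
def IsPolyMap {E V : Type*} [Field E] [AddCommGroup V] [Module E V] (m : ℕ) (g : E → V) : Prop :=
  ∃ a : ℕ → V, ∀ t, g t = ∑ i ∈ range (m + 1), t ^ i • a i

/-! ### Polynomial maps from a field to a module, with degree bounds -/

namespace IsPolyMap

open Finset

variable {E V : Type*} [Field E] [AddCommGroup V] [Module E V]

theorem of_eq_sum {m k : ℕ} (hk : k ≤ m) (a : ℕ → V) :
    IsPolyMap m (fun t : E => ∑ i ∈ range (k + 1), t ^ i • a i) := by
  refine ⟨fun i => if i ∈ range (k + 1) then a i else 0, fun t => ?_⟩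
  rw [← Finset.sum_subset (s₁ := range (k + 1))]
  · exact Finset.sum_congr rfl fun i hi => by simp only [if_pos hi]
  · intro i hi
    simp only [Finset.mem_range] at *
    omega
  · intro i _ hi
    simp only [if_neg hi, smul_zero]

theorem mono {m k : ℕ} {g : E → V} (hg : IsPolyMap k g) (hk : k ≤ m) : IsPolyMap m g := by
  obtain ⟨a, ha⟩ := hg
  rw [funext ha]
  exact of_eq_sum hk a

theorem add {m : ℕ} {g h : E → V} (hg : IsPolyMap m g) (hh : IsPolyMap m h) :
    IsPolyMap m (fun t => g t + h t) := by
  obtain ⟨a, ha⟩ := hg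
  obtain ⟨b, hb⟩ := hh
  exact ⟨fun i => a i + b i, fun t => by
    simp only [ha, hb, smul_add, Finset.sum_add_distrib]⟩

theorem zero (m : ℕ) : IsPolyMap m (fun _ : E => (0 : V)) := ⟨0, by simp⟩

theorem sum {ι : Type*} (s : Finset ι) {m : ℕ} {g : ι → E → V}
    (hg : ∀ i ∈ s, IsPolyMap m (g i)) : IsPolyMap m (fun t => ∑ i ∈ s, g i t) := by
  classical
  induction s using Finset.induction_on with
  | empty => simpa using zero m
  | insert i s hi ih =>
    simp only [Finset.sum_insert hi]
    exact (hg i (by simp)).add (ih fun j hj => hg j (by simp [hj]))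

theorem map {W : Type*} [AddCommGroup W] [Module E W] (f : V →ₗ[E] W) {m : ℕ} {g : E → V}
    (hg : IsPolyMap m g) : IsPolyMap m (fun t => f (g t)) := by
  obtain ⟨a, ha⟩ := hg
  exact ⟨fun i => f (a i), fun t => by simp [ha]⟩

theorem monomial {m k : ℕ} (hk : k ≤ m) (v : V) : IsPolyMap m (fun t : E => t ^ k • v) := by
  have := of_eq_sum (E := E) hk (fun i => if i = k then v else 0)
  simpa using this

theorem const (m : ℕ) (v : V) : IsPolyMap m (fun _ : E => v) := by
  simpa using monomial (E := E) (Nat.zero_le m) v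

theorem id {m : ℕ} (hm : 1 ≤ m) : IsPolyMap m (fun t : E => t) := by
  simpa using monomial (E := E) hm (1 : E)

theorem mul {A : Type*} [Ring A] [Algebra E A] {m k : ℕ} {g h : E → A} (hg : IsPolyMap m g)
    (hh : IsPolyMap k h) : IsPolyMap (m + k) (fun t => g t * h t) := by
  obtain ⟨a, ha⟩ := hg
  obtain ⟨b, hb⟩ := hh
  simp only [ha, hb, Finset.sum_mul_sum]
  refine sum _ fun i hi => sum _ fun j hj => ?_
  simp only [smul_mul_smul_comm, ← pow_add]
  simp only [Finset.mem_range] at hi hj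
  exact monomial (by omega) _

theorem pow {A : Type*} [Ring A] [Algebra E A] {m : ℕ} {g : E → A} (hg : IsPolyMap m g) (k : ℕ) :
    IsPolyMap (k * m) (fun t => g t ^ k) := by
  induction k with
  | zero => simpa using const 0 (1 : A)
  | succ k ih =>
    simp only [pow_succ, add_mul, one_mul]
    exact ih.mul hg

theorem prod {ι : Type*} (s : Finset ι) {m : ℕ} {g : ι → E → E}
    (hg : ∀ i ∈ s, IsPolyMap m (g i)) : IsPolyMap (#s * m) (fun t => ∏ i ∈ s, g i t) := by
  classical
  induction s using Finset.induction_on with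
  | empty => simpa using const 0 (1 : E)
  | insert i s hi ih =>
    simp only [Finset.prod_insert hi, Finset.card_insert_of_notMem hi]
    exact ((hg i (by simp)).mul (ih fun j hj => hg j (by simp [hj]))).mono
      (by rw [add_mul, one_mul, add_comm])

theorem comp {m k : ℕ} {g : E → V} {h : E → E} (hg : IsPolyMap m g) (hh : IsPolyMap k h) :
    IsPolyMap (m * k) (fun t => g (h t)) := by
  obtain ⟨a, ha⟩ := hg
  simp only [ha]
  refine sum _ fun i hi => ?_
  have h1 : IsPolyMap (m * k) (fun t => h t ^ i) :=
    (hh.pow i).mono (Nat.mul_le_mul_right _ (by simp at hi; omega))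
  simpa using h1.map (LinearMap.toSpanSingleton E V (a i))

theorem exists_mem_ne_zero {m : ℕ} {g : E → E} (hg : IsPolyMap m g) {t₀ : E} (h₀ : g t₀ ≠ 0)
    (s : Finset E) (hs : m < #s) : ∃ t ∈ s, g t ≠ 0 := by
  obtain ⟨a, ha⟩ := hg
  by_contra! h
  let p : Polynomial E := ∑ i ∈ range (m + 1), Polynomial.C (a i) * Polynomial.X ^ i
  have hp : ∀ t, p.eval t = g t := fun t => by
    rw [ha, Polynomial.eval_finsetSum]
    refine Finset.sum_congr rfl fun i _ => ?_
    rw [Polynomial.eval_mul, Polynomial.eval_C, Polynomial.eval_pow, Polynomial.eval_X,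
      smul_eq_mul, mul_comm]
  have hdeg : p.degree < #s := by
    refine lt_of_le_of_lt (Polynomial.degree_sum_le _ _) ?_
    rw [Finset.sup_lt_iff (by exact_mod_cast WithBot.bot_lt_coe (#s))]
    intro i hi
    refine lt_of_le_of_lt (Polynomial.degree_C_mul_X_pow_le _ _) ?_
    simp only [Finset.mem_range] at hi
    exact_mod_cast (by omega : i < #s)
  have : p = 0 := Polynomial.eq_zero_of_degree_lt_of_eval_finset_eq_zero s hdeg
    fun x hx => by rw [hp, h x hx]
  exact h₀ (by rw [← hp, this, Polynomial.eval_zero])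

end IsPolyMap

/-! ### Spanning the coefficients of a curve by few samples -/

section Condenser

open Finset

variable {E V : Type*} [Field E] [AddCommGroup V] [Module E V]

-- Every vector outside the span of its predecessors raises the dimension of the running span. Such
-- indices are the pivots of the sequence.
open Classical in
theorem card_filter_notMem_span_le [FiniteDimensional E V] (H : ℕ → V) (N : ℕ) :
    #{s ∈ range N | H s ∉ Submodule.span E (H '' Set.Iio s)} ≤
      Module.finrank E (Submodule.span E (H '' Set.Iio N)) := by
  induction N with
  | zero => simp
  | succ N ih =>
    have hle : Submodule.span E (H '' Set.Iio N) ≤ Submodule.span E (H '' Set.Iio (N + 1)) :=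
      Submodule.span_mono (Set.image_mono (Set.Iio_subset_Iio (Nat.le_succ N)))
    rw [Finset.range_add_one, Finset.filter_insert]
    split_ifs with h
    · exact ih.trans (Submodule.finrank_mono hle)
    · have hlt : Submodule.span E (H '' Set.Iio N) < Submodule.span E (H '' Set.Iio (N + 1)) := by
        refine lt_of_le_of_ne hle fun heq => h ?_
        rw [heq]
        exact Submodule.subset_span ⟨N, by simp, rfl⟩
      have := Submodule.finrank_lt_finrank_of_lt hlt
      refine (Finset.card_insert_le _ _).trans ?_
      omega

theorem mem_span_pivots (H : ℕ → V) (s : ℕ) :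
    H s ∈ Submodule.span E
      (H '' {a | a ≤ s ∧ H a ∉ Submodule.span E (H '' Set.Iio a)}) := by
  induction s using Nat.strong_induction_on with
  | _ s ih =>
    by_cases h : H s ∈ Submodule.span E (H '' Set.Iio s)
    · refine Submodule.span_le.2 ?_ h
      rintro _ ⟨b, hb, rfl⟩
      refine Submodule.span_mono (Set.image_mono ?_) (ih b hb)
      rintro a ⟨h1, h2⟩
      exact ⟨h1.trans (le_of_lt hb), h2⟩
    · exact Submodule.subset_span ⟨s, ⟨le_rfl, h⟩, rfl⟩

-- Echelon form of the sequence: each vector is a combination of pivots of index at most its own,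
-- and a pivot is expressed by itself. This triangular shape is what makes the determinant in the
-- condenser nonzero.
open Classical in
theorem exists_pivot_coeffs (H : ℕ → V) (N : ℕ) :
    ∃ c : ℕ → ℕ → E,
      (∀ s ∈ range N, H s = ∑ a ∈ range N with H a ∉ Submodule.span E (H '' Set.Iio a),
        c s a • H a) ∧
      (∀ s a, s < a → c s a = 0) ∧
      (∀ a, H a ∉ Submodule.span E (H '' Set.Iio a) → c a a = 1) := by
  classical
  have key : ∀ s, ∃ c : ℕ → E, (s ∈ range N →
      H s = ∑ a ∈ range N with H a ∉ Submodule.span E (H '' Set.Iio a), c a • H a) ∧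
      (∀ a, s < a → c a = 0) ∧ (H s ∉ Submodule.span E (H '' Set.Iio s) → c s = 1) := by
    intro s
    by_cases h : H s ∉ Submodule.span E (H '' Set.Iio s)
    · refine ⟨Pi.single s 1, fun hs => ?_, fun a ha => by simp [ha.ne'], fun _ => by simp⟩
      rw [Finset.sum_eq_single s]
      · simp
      · intro b _ hb
        simp [hb]
      · intro h'
        exact absurd (Finset.mem_filter.2 ⟨hs, h⟩) h'
    · let T : Finset ℕ := {a ∈ range (s + 1) | H a ∉ Submodule.span E (H '' Set.Iio a)}
      have hT : H s ∈ Submodule.span E (H '' (T : Set ℕ)) := by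
        convert mem_span_pivots H s using 3
        ext a
        simp [T]
      obtain ⟨c, hc⟩ := (Submodule.mem_span_image_finset_iff_exists_fun E).1 hT
      refine ⟨fun a => if h : a ∈ T then c ⟨a, h⟩ else 0, fun hs => ?_, fun a ha => ?_,
        fun h' => absurd h' h⟩
      · rw [← hc, ← Finset.sum_subset (s₁ := T)]
        · rw [← Finset.sum_coe_sort T]
          exact Finset.sum_congr rfl fun i _ => by simp
        · intro a ha
          simp only [T, Finset.mem_filter, Finset.mem_range] at ha hs ⊢
          exact ⟨by omega, ha.2⟩
        · intro a _ ha
          simp only [dif_neg ha, zero_smul]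
      · have : a ∉ T := by
          simp only [T, Finset.mem_filter, Finset.mem_range]
          omega
        simp only [dif_neg this]
  choose c h1 h2 h3 using key
  exact ⟨c, h1, h2, h3⟩

/-- A polynomial curve in a space of dimension at most `R`, sampled at `R` points of a generic
geometric progression: the samples span all coefficients of the curve. -/
theorem exists_polynomial_condenser [FiniteDimensional E V] {R : ℕ} (hR : Module.finrank E V ≤ R)
    (H : ℕ → V) (N : ℕ) {w : E} (hw : Set.InjOn (fun j => w ^ j) (Set.Iio N)) :
    ∃ p : Polynomial E, p ≠ 0 ∧ ∀ α : E, p.eval α ≠ 0 → ∀ s < N,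
      H s ∈ Submodule.span E
        ((fun l : ℕ => ∑ s ∈ range N, (α * w ^ l) ^ s • H s) '' Set.Iio R) := by
  classical
  obtain ⟨c, hc, hc0, hc1⟩ := exists_pivot_coeffs (E := E) H N
  set I : Finset ℕ := {a ∈ range N | H a ∉ Submodule.span E (H '' Set.Iio a)} with hI
  have hcard : #I ≤ R := (card_filter_notMem_span_le H N).trans
    ((Submodule.finrank_le _).trans hR)
  obtain ⟨ρ, hρ⟩ : ∃ ρ, #I = ρ := ⟨_, rfl⟩
  let a : Fin ρ ↪o ℕ := I.orderEmbOfFin hρ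
  have haI : ∀ k, a k ∈ I := fun k => I.orderEmbOfFin_mem hρ k
  have hsum : ∀ f : ℕ → V, ∑ x ∈ I, f x = ∑ k, f (a k) := fun f => by
    rw [← Finset.sum_image (f := f) (g := a) (s := univ) (fun x _ y _ h => a.injective h)]
    congr 1
    ext x
    have := I.range_orderEmbOfFin hρ
    simp only [Finset.mem_image, Finset.mem_univ, true_and]
    rw [← Finset.mem_coe, ← this]
    rfl
  -- The matrix expressing the samples by the pivot vectors, with X^(a k) divided out of column k;
  -- this is possible because only s ≥ a k contributes.
  let P : Matrix (Fin ρ) (Fin ρ) (Polynomial E) := fun l k =>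
    ∑ s ∈ range N, Polynomial.C (c s (a k) * w ^ ((l : ℕ) * s)) * Polynomial.X ^ (s - a k)
  have hPdef : ∀ l k, P l k =
    ∑ s ∈ range N, Polynomial.C (c s (a k) * w ^ ((l : ℕ) * s)) * Polynomial.X ^ (s - a k) :=
    fun _ _ => rfl
  have haN : ∀ k, a k < N := fun k => by
    have := haI k
    rw [hI, Finset.mem_filter, Finset.mem_range] at this
    exact this.1
  have hacc : ∀ k, c (a k) (a k) = 1 := fun k => by
    have := haI k
    rw [hI, Finset.mem_filter] at this
    exact hc1 _ this.2
  -- At X = 0 only the term s = a k survives in column k, with coefficient 1.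
  have hP0 : P.map (Polynomial.eval 0) = (Matrix.vandermonde fun k => w ^ a k).transpose := by
    ext l k
    simp only [Matrix.map_apply, hPdef, Polynomial.eval_finsetSum, Matrix.transpose_apply,
      Matrix.vandermonde_apply]
    rw [Finset.sum_eq_single (a k)]
    · simp [hacc, ← pow_mul, mul_comm]
    · intro s _ hs
      rcases lt_or_gt_of_ne hs with h | h
      · simp [hc0 _ _ h]
      · have : s - a k ≠ 0 := by omega
        simp [this]
    · intro h
      exact absurd (Finset.mem_range.2 (haN k)) h
  have hdet : ∀ α, P.det.eval α = (P.map (Polynomial.eval α)).det := fun α => by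
    have := RingHom.map_det (Polynomial.evalRingHom α) P
    simpa using this
  have hdet0 : P.det ≠ 0 := by
    intro h
    have h0 := hdet 0
    rw [h, Polynomial.eval_zero, hP0, Matrix.det_transpose] at h0
    refine Matrix.det_vandermonde_ne_zero_iff.2 ?_ h0.symm
    intro k k' hk
    exact a.injective (hw (haN k) (haN k') hk)
  -- The additional factor X forces α ≠ 0, so that the powers α^(a k) can be cancelled at the end.
  refine ⟨Polynomial.X * P.det, mul_ne_zero Polynomial.X_ne_zero hdet0, fun α hα s hs => ?_⟩
  rw [Polynomial.eval_mul, Polynomial.eval_X, hdet] at hα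
  have hα0 := left_ne_zero_of_mul hα
  have hQ := right_ne_zero_of_mul hα
  set Q := P.map (Polynomial.eval α) with hQdef
  set S := Submodule.span E ((fun l : ℕ => ∑ s ∈ range N, (α * w ^ l) ^ s • H s) '' Set.Iio R)
  have hG : ∀ l : Fin ρ, ∑ s ∈ range N, (α * w ^ (l : ℕ)) ^ s • H s =
      ∑ k, Q l k • (α ^ a k • H (a k)) := by
    intro l
    have : ∀ s ∈ range N, (α * w ^ (l : ℕ)) ^ s • H s =
        ∑ k, ((α * w ^ (l : ℕ)) ^ s * c s (a k)) • H (a k) := by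
      intro s hs
      conv_lhs => rw [hc s hs, hsum]
      rw [Finset.smul_sum]
      simp only [smul_smul]
    rw [Finset.sum_congr rfl this, Finset.sum_comm]
    refine Finset.sum_congr rfl fun k _ => ?_
    rw [← Finset.sum_smul, smul_smul]
    congr 1
    simp only [hQdef, Matrix.map_apply, hPdef, Polynomial.eval_finsetSum, Finset.sum_mul]
    refine Finset.sum_congr rfl fun s _ => ?_
    rcases lt_or_ge s (a k) with h | h
    · simp [hc0 _ _ h]
    · obtain ⟨j, rfl⟩ := Nat.exists_eq_add_of_le h
      simp only [Polynomial.eval_mul, Polynomial.eval_C, Polynomial.eval_pow, Polynomial.eval_X,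
        Nat.add_sub_cancel_left]
      ring
  have hmem : ∀ k, H (a k) ∈ S := by
    intro k
    have h1 : α ^ a k • H (a k) =
        ∑ l, Q⁻¹ k l • ∑ s ∈ range N, (α * w ^ (l : ℕ)) ^ s • H s := by
      simp only [hG, Finset.smul_sum, smul_smul]
      rw [Finset.sum_comm]
      have : ∀ k', ∑ l, (Q⁻¹ k l * Q l k' * α ^ a k') • H (a k') =
          ((1 : Matrix (Fin ρ) (Fin ρ) E) k k' * α ^ a k') • H (a k') := by
        intro k'
        rw [← Finset.sum_smul, ← Finset.sum_mul, ← Matrix.mul_apply,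
          Matrix.nonsing_inv_mul _ (isUnit_iff_ne_zero.2 hQ)]
      simp only [← mul_assoc, this, Matrix.one_apply, ite_mul, one_mul, zero_mul, ite_smul,
        zero_smul]
      simp
    have h2 : α ^ a k • H (a k) ∈ S := by
      rw [h1]
      refine Submodule.sum_mem _ fun l _ => Submodule.smul_mem _ _ (Submodule.subset_span ?_)
      exact ⟨l, by simp only [Set.mem_Iio]; omega, rfl⟩
    have := S.smul_mem (α ^ a k)⁻¹ h2
    rwa [smul_smul, inv_mul_cancel₀ (pow_ne_zero _ hα0), one_smul] at this
  rw [hc s (Finset.mem_range.2 hs), hsum]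
  exact Submodule.sum_mem _ fun k _ => Submodule.smul_mem _ _ (hmem k)

end Condenser

/-! ### Products of two curves in a finite-dimensional algebra -/

section Merge

open Finset

variable {E A : Type*} [Field E] [Ring A] [Algebra E A]

/-- The spanning vectors are the coefficients of f(t) g(w^q t), q < R. If a functional kills them
all but not every a_i b_j, consider the least total degree s at which it is nonzero. Minimality
makes the a_(s-j) with nonzero values independent, so there are at most R of them, and R Vandermonde
equations in the distinct w^j force these values to vanish. -/
theorem mul_mem_span_antidiagonal [FiniteDimensional E A] {R : ℕ}
    (hR : Module.finrank E A ≤ R) {m : ℕ} {a b : ℕ → A} (ha : ∀ i, m < i → a i = 0)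
    (hb : ∀ i, m < i → b i = 0) {w : E} (hw : Set.InjOn (fun j => w ^ j) (Set.Iio (m + 1)))
    (i j : ℕ) :
    a i * b j ∈ Submodule.span E
      {v | ∃ q < R, ∃ s < 2 * m + 1,
        v = ∑ p ∈ antidiagonal s, w ^ (q * p.2) • (a p.1 * b p.2)} := by
  classical
  by_contra hij
  obtain ⟨f, hf, hker⟩ := Submodule.exists_le_ker_of_notMem hij
  have hex : ∃ s, ∃ i j, i + j = s ∧ f (a i * b j) ≠ 0 := ⟨i + j, i, j, rfl, hf⟩
  obtain ⟨i₁, j₁, hs, h₁⟩ := Nat.find_spec hex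
  have hmin : ∀ i j, i + j < Nat.find hex → f (a i * b j) = 0 := fun i j h => by
    by_contra h'
    exact Nat.find_min hex h ⟨i, j, rfl, h'⟩
  generalize Nat.find hex = s at hs hmin
  have ham : ∀ i j, f (a i * b j) ≠ 0 → i ≤ m ∧ j ≤ m := by
    intro i j h
    constructor <;> by_contra h'
    · exact h (by rw [ha i (by omega), zero_mul, map_zero])
    · exact h (by rw [hb j (by omega), mul_zero, map_zero])
  let J : Finset ℕ := {j ∈ range (s + 1) | f (a (s - j) * b j) ≠ 0}
  have hJ : ∀ j, j ∈ J ↔ j ≤ s ∧ f (a (s - j) * b j) ≠ 0 := by simp [J]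
  have hli : LinearIndependent E (fun j : J => a (s - j)) := by
    rw [linearIndependent_iff']
    intro T c hT
    by_contra! hne
    obtain ⟨j₀, hj₀⟩ := hne
    let T' : Finset J := {j ∈ T | c j ≠ 0}
    have hT' : T'.Nonempty := ⟨j₀, by simp [T', hj₀]⟩
    -- Multiply the relation by b_(j') for the least j' that occurs: every other term has total
    -- degree s - j + j' < s, where the functional is zero.
    obtain ⟨j', hj', hle⟩ := T'.exists_min_image (fun j => (j : ℕ)) hT'
    simp only [T', Finset.mem_filter] at hj' hle
    have h0 : f ((∑ j ∈ T, c j • a (s - j)) * b j') = 0 := by rw [hT, zero_mul, map_zero]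
    rw [Finset.sum_mul, map_sum, Finset.sum_eq_single j'] at h0
    · rw [smul_mul_assoc, map_smul, smul_eq_mul] at h0
      exact mul_ne_zero hj'.2 ((hJ _).1 j'.2).2 h0
    · intro j hj hne
      by_cases hc : c j = 0
      · rw [hc, zero_smul, zero_mul, map_zero]
      · have h1 := hle j ⟨hj, hc⟩
        have h2 : (j : ℕ) ≠ j' := fun h => hne (Subtype.ext h)
        have h3 := ((hJ _).1 j.2).1
        rw [smul_mul_assoc, map_smul, hmin _ _ (by omega), smul_zero]
    · intro h
      exact absurd hj'.1 h
  have hcard : #J ≤ R := by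
    have := hli.fintype_card_le_finrank
    rw [Fintype.card_coe] at this
    exact this.trans hR
  obtain ⟨ρ, hρ⟩ : ∃ ρ, #J = ρ := ⟨_, rfl⟩
  let e : Fin ρ ≃ J := (J.equivFinOfCardEq hρ).symm
  have hinj : Function.Injective (fun k : Fin ρ => w ^ ((e k : J) : ℕ)) := by
    intro k k' h
    refine e.injective (Subtype.ext (hw ?_ ?_ h)) <;> simp only [Set.mem_Iio]
    · have := (ham _ _ ((hJ _).1 (e k).2).2).2
      omega
    · have := (ham _ _ ((hJ _).1 (e k').2).2).2
      omega
  have hv := Matrix.eq_zero_of_forall_pow_sum_mul_pow_eq_zero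
    (v := fun k : Fin ρ => f (a (s - (e k : J)) * b (e k : J))) hinj ?_
  · have hj₁ : j₁ ∈ J := by
      rw [hJ]
      refine ⟨by omega, ?_⟩
      rwa [show s - j₁ = i₁ by omega]
    have := congrFun hv (e.symm ⟨j₁, hj₁⟩)
    simp only [Equiv.apply_symm_apply, Pi.zero_apply] at this
    exact ((hJ _).1 hj₁).2 this
  · intro q
    have hms := ham _ _ h₁
    have h0 : f (∑ p ∈ antidiagonal s, w ^ ((q : ℕ) * p.2) • (a p.1 * b p.2)) = 0 :=
      hker (Submodule.subset_span ⟨q, by omega, s, by omega, rfl⟩)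
    rw [map_sum, Finset.Nat.sum_antidiagonal_eq_sum_range_succ_mk,
      ← Finset.sum_range_reflect] at h0
    rw [Equiv.sum_comp e (fun j : J => f (a (s - j) * b j) * (w ^ (j : ℕ)) ^ (q : ℕ)),
      Finset.sum_coe_sort J (fun j => f (a (s - j) * b j) * (w ^ (j : ℕ)) ^ (q : ℕ)),
      Finset.sum_subset (s₂ := range (s + 1))]
    · rw [← h0]
      refine Finset.sum_congr rfl fun j hj => ?_
      rw [Finset.mem_range] at hj
      simp only [map_smul, smul_eq_mul]
      rw [show s + 1 - 1 - j = s - j by omega, show s - (s - j) = j by omega, ← pow_mul, mul_comm,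
        mul_comm j]
    · intro j hj
      exact Finset.mem_range.2 (by have := ((hJ j).1 hj).1; omega)
    · intro j hj hj'
      rw [Finset.mem_range] at hj
      have : f (a (s - j) * b j) = 0 := by
        by_contra h
        exact hj' ((hJ j).2 ⟨by omega, h⟩)
      rw [this, zero_mul]

/-- The products `f u * g v` of two polynomial curves in an algebra of dimension at most `R` are
spanned by the products taken at `R * R` points on the lines `v = w ^ q * u`, for generic `α`. -/
theorem exists_polynomial_merge [FiniteDimensional E A] {R : ℕ} (hR : Module.finrank E A ≤ R)
    {m : ℕ} {f g : E → A} (hf : IsPolyMap m f) (hg : IsPolyMap m g) {w : E}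
    (hw : Set.InjOn (fun j => w ^ j) (Set.Iio (2 * m + 1))) :
    ∃ p : Polynomial E, p ≠ 0 ∧ ∀ α : E, p.eval α ≠ 0 → ∀ u v,
      f u * g v ∈ Submodule.span E
        ((fun c : ℕ => f (α * w ^ (c / R)) * g (α * w ^ (c / R + c % R))) '' Set.Iio (R * R)) := by
  classical
  obtain ⟨a', ha'⟩ := hf
  obtain ⟨b', hb'⟩ := hg
  -- The coefficients above degree m are arbitrary in `IsPolyMap`; here they are set to zero.
  obtain ⟨a, ha, hfa⟩ : ∃ a : ℕ → A, (∀ i, m < i → a i = 0) ∧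
      ∀ t, f t = ∑ i ∈ range (m + 1), t ^ i • a i := by
    refine ⟨fun i => if m < i then 0 else a' i, fun i hi => if_pos hi, fun t => ?_⟩
    rw [ha']
    refine Finset.sum_congr rfl fun i hi => ?_
    simp only [if_neg (show ¬ m < i by simp at hi; omega)]
  obtain ⟨b, hb, hgb⟩ : ∃ b : ℕ → A, (∀ i, m < i → b i = 0) ∧
      ∀ t, g t = ∑ i ∈ range (m + 1), t ^ i • b i := by
    refine ⟨fun i => if m < i then 0 else b' i, fun i hi => if_pos hi, fun t => ?_⟩
    rw [hb']
    refine Finset.sum_congr rfl fun i hi => ?_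
    simp only [if_neg (show ¬ m < i by simp at hi; omega)]
  have hfb : ∀ t, f t = ∑ i ∈ range (2 * m + 1), t ^ i • a i := fun t => by
    rw [hfa]
    refine Finset.sum_subset (Finset.range_subset_range.2 (by omega)) fun i _ hi => ?_
    rw [ha i (by simp at hi; omega), smul_zero]
  have hgb' : ∀ t, g t = ∑ i ∈ range (2 * m + 1), t ^ i • b i := fun t => by
    rw [hgb]
    refine Finset.sum_subset (Finset.range_subset_range.2 (by omega)) fun i _ hi => ?_
    rw [hb i (by simp at hi; omega), smul_zero]
  let H : ℕ → ℕ → A := fun q s => ∑ p ∈ antidiagonal s, w ^ (q * p.2) • (a p.1 * b p.2)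
  have hG : ∀ q t, f t * g (t * w ^ q) = ∑ s ∈ range (2 * m + 1), t ^ s • H q s := by
    intro q t
    rw [hfa, hgb, Finset.sum_mul_sum, ← Finset.sum_product']
    simp only [H, Finset.smul_sum]
    rw [Finset.sum_sigma' (range (2 * m + 1)) (fun s => antidiagonal s)
      (fun s p => t ^ s • w ^ (q * p.2) • (a p.1 * b p.2))]
    refine Finset.sum_bij_ne_zero (fun p _ _ => ⟨p.1 + p.2, p⟩) ?_ ?_ ?_ ?_
    · rintro ⟨i, j⟩ h _
      simp at h ⊢
      omega
    · rintro ⟨i, j⟩ _ _ ⟨i', j'⟩ _ _ h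
      simp at h ⊢
      omega
    · rintro ⟨s, i, j⟩ h hne
      simp at h
      obtain ⟨h, rfl⟩ := h
      have hi : i ≤ m := by
        by_contra hi
        simp [ha i (by omega)] at hne
      have hj : j ≤ m := by
        by_contra hj
        simp [hb j (by omega)] at hne
      refine ⟨(i, j), by simp; omega, ?_, rfl⟩
      convert hne using 1
      simp only [smul_mul_smul_comm, smul_smul, mul_pow]
      congr 1
      ring
    · rintro ⟨i, j⟩ _ _
      simp only [smul_mul_smul_comm, smul_smul, mul_pow]
      congr 1
      ring
  choose p hp0 hp using fun q => exists_polynomial_condenser (E := E) hR (H q) (2 * m + 1) hw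
  refine ⟨∏ q ∈ range R, p q, Finset.prod_ne_zero_iff.2 fun q _ => hp0 q, fun α hα u v => ?_⟩
  rw [Polynomial.eval_prod, Finset.prod_ne_zero_iff] at hα
  have hspan : ∀ i j, a i * b j ∈ Submodule.span E
        ((fun c : ℕ => f (α * w ^ (c / R)) * g (α * w ^ (c / R + c % R))) '' Set.Iio (R * R)) := by
    intro i j
    refine Submodule.span_le.2 ?_ (mul_mem_span_antidiagonal hR ha hb
      (hw.mono (Set.Iio_subset_Iio (by omega))) i j)
    rintro _ ⟨q, hq, s, hs, rfl⟩
    refine Submodule.span_mono ?_ (hp q α (hα q (Finset.mem_range.2 hq)) s hs)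
    rintro _ ⟨l, hl, rfl⟩
    simp only [Set.mem_Iio] at hl
    -- The index c encodes the sample number l = c / R and the line q = c % R.
    refine ⟨l * R + q, ?_, ?_⟩
    · simp only [Set.mem_Iio]
      nlinarith
    · have h1 : (l * R + q) / R = l := by
        rw [Nat.add_comm, Nat.add_mul_div_right _ _ (by omega), Nat.div_eq_of_lt hq, zero_add]
      have h2 : (l * R + q) % R = q := by
        rw [Nat.add_comm, Nat.add_mul_mod_self_right, Nat.mod_eq_of_lt hq]
      simp only [h1, h2]
      rw [← hG, mul_assoc, pow_add]
  rw [hfa, hgb, Finset.sum_mul_sum]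
  refine Submodule.sum_mem _ fun i _ => Submodule.sum_mem _ fun j _ => ?_
  rw [smul_mul_smul_comm]
  exact Submodule.smul_mem _ _ (hspan i j)

end Merge

/-! ### The interpolated curves -/

section Curve

open Finset

variable {E : Type*} [Field E]

open Classical in
/-- The value at `u` of the `c`-th Lagrange basis polynomial for the nodes `1, w, …, w ^ (K - 1)`. -/
noncomputable def lagr (w : E) (K c : ℕ) (u : E) : E :=
  ∏ j ∈ range K, if w ^ c = w ^ j then 1 else (u - w ^ j) * (w ^ c - w ^ j)⁻¹

/-- The exponent of the `c`-th sample point of the coordinate `b` when blocks of length `2 ^ k` are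
merged; it depends on whether `b` lies in the left or in the right one of two adjacent blocks. -/
def shift (R b k c : ℕ) : ℕ := c / R + c % (if b / 2 ^ k % 2 = 0 then 1 else R)

/-- The coordinate `b` of the nodes of the curve of level `k` with seeds `α`. -/
noncomputable def nodes (w : E) (K R : ℕ) (α : ℕ → E) (b : ℕ) : ℕ → ℕ → E
  | 0, c => w ^ c
  | k + 1, c => ∑ c' ∈ range K, lagr w K c' (α k * w ^ shift R b k c) * nodes w K R α b k c'

/-- The coordinate `b` of the curve of level `k` with seeds `α`. -/
noncomputable def curve (w : E) (K R : ℕ) (α : ℕ → E) (k b : ℕ) (u : E) : E :=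
  ∑ c ∈ range K, lagr w K c u * nodes w K R α b k c

variable {w : E} {K R : ℕ}

theorem lagr_node (hw : Set.InjOn (fun j => w ^ j) (Set.Iio K)) {c c' : ℕ} (hc : c < K)
    (hc' : c' < K) : lagr w K c (w ^ c') = if c = c' then 1 else 0 := by
  unfold lagr
  split_ifs with h
  · subst h
    refine Finset.prod_eq_one fun j _ => ?_
    split_ifs with h'
    · rfl
    · exact mul_inv_cancel₀ (sub_ne_zero.2 h')
  · refine Finset.prod_eq_zero (Finset.mem_range.2 hc') ?_
    rw [if_neg fun h' => h (hw hc hc' h'), sub_self, zero_mul]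

/-- The factor j = c is 1 and each of the others is constant or linear, even if powers of w
coincide. -/
theorem isPolyMap_lagr {c : ℕ} (hc : c < K) : IsPolyMap (K - 1) (lagr w K c) := by
  classical
  have h1 : lagr w K c = fun u => ∏ j ∈ (range K).erase c,
      if w ^ c = w ^ j then 1 else (u - w ^ j) * (w ^ c - w ^ j)⁻¹ := by
    funext u
    rw [lagr, ← Finset.mul_prod_erase _ _ (Finset.mem_range.2 hc), if_pos rfl, one_mul]
  rw [h1]
  have h2 : ∀ j ∈ (range K).erase c, IsPolyMap 1 (fun u : E =>
      if w ^ c = w ^ j then 1 else (u - w ^ j) * (w ^ c - w ^ j)⁻¹) := by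
    intro j _
    split_ifs
    · exact IsPolyMap.const 1 (1 : E)
    · simp only [sub_eq_add_neg]
      exact ((IsPolyMap.id le_rfl).add (IsPolyMap.const 1 _)).mul (IsPolyMap.const 0 _)
  have := IsPolyMap.prod _ h2
  rwa [mul_one, Finset.card_erase_of_mem (Finset.mem_range.2 hc), Finset.card_range] at this

theorem isPolyMap_curve (α : ℕ → E) (k b : ℕ) : IsPolyMap (K - 1) (curve w K R α k b) := by
  refine IsPolyMap.sum _ fun c hc => ?_
  simpa using (isPolyMap_lagr (w := w) (Finset.mem_range.1 hc)).mul
    (IsPolyMap.const 0 (nodes w K R α b k c))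

theorem curve_node (hw : Set.InjOn (fun j => w ^ j) (Set.Iio K)) (α : ℕ → E) (k b : ℕ) {c : ℕ}
    (hc : c < K) : curve w K R α k b (w ^ c) = nodes w K R α b k c := by
  rw [curve, Finset.sum_eq_single c]
  · rw [lagr_node hw hc hc, if_pos rfl, one_mul]
  · intro c' hc' h
    rw [lagr_node hw (Finset.mem_range.1 hc') hc, if_neg h, zero_mul]
  · intro h
    exact absurd (Finset.mem_range.2 hc) h

theorem curve_succ_node (hw : Set.InjOn (fun j => w ^ j) (Set.Iio K)) (α : ℕ → E) (k b : ℕ) {c : ℕ}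
    (hc : c < K) :
    curve w K R α (k + 1) b (w ^ c) = curve w K R α k b (α k * w ^ shift R b k c) := by
  rw [curve_node hw α _ b hc]
  rfl

/-- The identity has degree 1, so two nodes suffice to recover it. This is why the curves use R² + 1
nodes although R² samples are enough for a merge: R may be 1. -/
theorem curve_zero (hw : Set.InjOn (fun j => w ^ j) (Set.Iio K)) (hK : 2 ≤ K) (α : ℕ → E) (b : ℕ)
    (u : E) : curve w K R α 0 b u = u := by
  classical
  by_contra h
  have hp : IsPolyMap (K - 1) (fun u => curve w K R α 0 b u + (-1) * u) :=
    (isPolyMap_curve α 0 b).add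
      (((IsPolyMap.const 0 (-1 : E)).mul (IsPolyMap.id le_rfl)).mono (by omega))
  have hcard : #((range K).image fun j => w ^ j) = K := by
    rw [Finset.card_image_of_injOn, Finset.card_range]
    simpa using hw
  obtain ⟨t, ht, hne⟩ := hp.exists_mem_ne_zero (t₀ := u)
    (by simpa [← sub_eq_add_neg, sub_eq_zero] using h) ((range K).image fun j => w ^ j) (by omega)
  obtain ⟨c, hc, rfl⟩ := Finset.mem_image.1 ht
  rw [curve_node hw α 0 b (Finset.mem_range.1 hc)] at hne
  simp [nodes] at hne

theorem nodes_congr {α α' : ℕ → E} (b k : ℕ) (h : ∀ j < k, α j = α' j) :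
    nodes w K R α b k = nodes w K R α' b k := by
  induction k with
  | zero => rfl
  | succ k ih =>
    funext c
    simp only [nodes, h k k.lt_succ_self, ih fun j hj => h j (Nat.lt_succ_of_lt hj)]

theorem curve_congr {α α' : ℕ → E} (k b : ℕ) (h : ∀ j < k, α j = α' j) :
    curve w K R α k b = curve w K R α' k b := by
  funext u
  simp only [curve, nodes_congr b k h]

/-- A seed enters at one level only, through Lagrange polynomials of degree K - 1, and the later
levels are linear in the nodes. Hence the degree in a single seed does not depend on the number of
levels. -/
theorem isPolyMap_nodes_update (α : ℕ → E) (b j k c : ℕ) :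
    IsPolyMap (K - 1) (fun t => nodes w K R (Function.update α j t) b k c) := by
  induction k generalizing c with
  | zero => exact IsPolyMap.const _ _
  | succ k ih =>
    simp only [nodes]
    refine IsPolyMap.sum _ fun c' hc' => ?_
    rcases eq_or_ne k j with rfl | hkj
    · have h1 : ∀ t, nodes w K R (Function.update α k t) b k = nodes w K R α b k := fun t =>
        nodes_congr b k fun i hi => Function.update_of_ne hi.ne _ _
      simp only [Function.update_self, h1]
      have h2 := (isPolyMap_lagr (w := w) (Finset.mem_range.1 hc')).comp
        ((IsPolyMap.id (E := E) le_rfl).mul (IsPolyMap.const 0 (w ^ shift R b k c)))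
      simpa using h2.mul (IsPolyMap.const 0 (nodes w K R α b k c'))
    · simp only [Function.update_of_ne hkj]
      simpa using (IsPolyMap.const 0 (lagr w K c' (α k * w ^ shift R b k c))).mul (ih c')

/-- The parameter of the curve is treated as the k-th seed, which the curve of level k itself does
not use; seeds and parameter then obey one common degree bound. -/
theorem isPolyMap_curve_update (α : ℕ → E) (k b j : ℕ) :
    IsPolyMap (K - 1) (fun t => curve w K R (Function.update α j t) k b
      (Function.update α j t k)) := by
  rcases eq_or_ne k j with rfl | hkj
  · have h1 : ∀ t, curve w K R (Function.update α k t) k b = curve w K R α k b := fun t =>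
      curve_congr k b fun i hi => Function.update_of_ne hi.ne _ _
    simp only [h1, Function.update_self]
    exact isPolyMap_curve α k b
  · simp only [Function.update_of_ne hkj, curve]
    refine IsPolyMap.sum _ fun c _ => ?_
    simpa using (IsPolyMap.const 0 (lagr w K c (α k))).mul (isPolyMap_nodes_update α b j k c)

theorem map_lagr {E' : Type*} [Field E'] (σ : E →+* E') (w : E) (K c : ℕ) (u : E) :
    σ (lagr w K c u) = lagr (σ w) K c (σ u) := by
  classical
  simp only [lagr, map_prod]
  refine Finset.prod_congr rfl fun j _ => ?_
  have : σ w ^ c = σ w ^ j ↔ w ^ c = w ^ j := by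
    rw [← map_pow, ← map_pow, σ.injective.eq_iff]
  simp only [this]
  split_ifs <;> simp

theorem map_nodes {E' : Type*} [Field E'] (σ : E →+* E') (w : E) (K R : ℕ) (α : ℕ → E)
    (b k c : ℕ) : σ (nodes w K R α b k c) = nodes (σ w) K R (fun j => σ (α j)) b k c := by
  induction k generalizing c with
  | zero => simp [nodes]
  | succ k ih => simp [nodes, map_lagr, ih]

/-- Brings points found in the algebraic closure back to the base field, since their seeds are
powers of an element of that field. -/
theorem map_curve {E' : Type*} [Field E'] (σ : E →+* E') (w : E) (K R : ℕ) (α : ℕ → E)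
    (k b : ℕ) (u : E) :
    σ (curve w K R α k b u) = curve (σ w) K R (fun j => σ (α j)) k b (σ u) := by
  simp [curve, map_lagr, map_nodes]

end Curve

/-! ### Ordered products over dyadic blocks -/

section Block

open Finset

variable {E A : Type*} [Field E] [Ring A] [Algebra E A]

/-- The ordered product of the factors `M b (x b)` over the block `a * 2 ^ k ≤ b < (a + 1) * 2 ^ k`. -/
def block (M : ℕ → E → A) : ℕ → ℕ → (ℕ → E) → A
  | 0, a, x => M a (x a)
  | k + 1, a, x => block M k (2 * a) x * block M k (2 * a + 1) x

omit [Field E] [Algebra E A] in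
theorem block_congr (M : ℕ → E → A) (k a : ℕ) {x y : ℕ → E} (h : ∀ b, b / 2 ^ k = a → x b = y b) :
    block M k a x = block M k a y := by
  induction k generalizing a with
  | zero => simp only [block, h a (by simp)]
  | succ k ih =>
    have h2 : ∀ b, b / 2 ^ (k + 1) = b / 2 ^ k / 2 := fun b => by
      rw [Nat.div_div_eq_div_mul, pow_succ]
    simp only [block]
    rw [ih (2 * a) fun b hb => h b (by rw [h2]; omega),
      ih (2 * a + 1) fun b hb => h b (by rw [h2]; omega)]

theorem isPolyMap_block {M : ℕ → E → A} {δ m : ℕ} (hM : ∀ b, IsPolyMap δ (M b)) (k a : ℕ)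
    {x : ℕ → E → E} (hx : ∀ b, IsPolyMap m (x b)) :
    IsPolyMap (2 ^ k * (δ * m)) (fun t => block M k a (fun b => x b t)) := by
  induction k generalizing a with
  | zero => simpa [block] using (hM a).comp (hx a)
  | succ k ih =>
    simp only [block]
    exact ((ih (2 * a)).mul (ih (2 * a + 1))).mono (by rw [pow_succ]; ring_nf; rfl)

/-- Induction on the level: the span of the products of the two halves is the product of their
spans, and the merge lemma reduces it to R² samples, which are nodes of the next curve. -/
theorem exists_seeds_span_curve [Infinite E] [FiniteDimensional E A] {R L δ d : ℕ}
    (hR : Module.finrank E A ≤ R) (hR1 : 1 ≤ R) {w : E}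
    (hw : Set.InjOn (fun j => w ^ j) (Set.Iio L)) (hL : R * R + 1 ≤ L)
    (hd : 2 ^ d * (δ * (R * R)) < L) {M : ℕ → E → A} (hM : ∀ b, IsPolyMap δ (M b)) (k : ℕ)
    (hk : k ≤ d) :
    ∃ α : ℕ → E, ∀ a < 2 ^ (d - k), ∀ x, block M k a x ∈ Submodule.span E
      (Set.range fun u => block M k a (fun b => curve w (R * R + 1) R α k b u)) := by
  classical
  have hwK : Set.InjOn (fun j => w ^ j) (Set.Iio (R * R + 1)) :=
    hw.mono (Set.Iio_subset_Iio hL)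
  induction k with
  | zero =>
    refine ⟨0, fun a _ x => Submodule.subset_span ⟨x a, ?_⟩⟩
    simp only [block]
    rw [curve_zero hwK (by nlinarith)]
  | succ k ih =>
    obtain ⟨α, hα⟩ := ih (by omega)
    have hpoly : ∀ a, IsPolyMap (2 ^ k * (δ * (R * R)))
        (fun u => block M k a (fun b => curve w (R * R + 1) R α k b u)) := fun a =>
      isPolyMap_block hM k a (fun b => isPolyMap_curve α k b)
    have hle : 2 * (2 ^ k * (δ * (R * R))) + 1 ≤ L := by
      have : 2 ^ (k + 1) ≤ 2 ^ d := Nat.pow_le_pow_right (by norm_num) hk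
      have := Nat.mul_le_mul_right (δ * (R * R)) this
      rw [pow_succ, mul_comm (2 ^ k) 2, mul_assoc] at this
      omega
    choose p hp0 hp using fun a => exists_polynomial_merge hR (hpoly (2 * a)) (hpoly (2 * a + 1))
      (hw.mono (Set.Iio_subset_Iio hle))
    -- One seed avoids the exceptional values of all blocks of the level, because a finite product
    -- of nonzero polynomials is nonzero and E is infinite.
    obtain ⟨t, ht⟩ : ∃ t, (∏ a ∈ range (2 ^ (d - (k + 1))), p a).eval t ≠ 0 := by
      by_contra! h
      exact Finset.prod_ne_zero_iff.2 (fun a _ => hp0 a) (Polynomial.funext (by simpa using h))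
    rw [Polynomial.eval_prod, Finset.prod_ne_zero_iff] at ht
    refine ⟨Function.update α k t, fun a ha x => ?_⟩
    have hcur : ∀ b, curve w (R * R + 1) R (Function.update α k t) k b =
        curve w (R * R + 1) R α k b := fun b =>
      curve_congr k b fun i hi => Function.update_of_ne hi.ne _ _
    have h2 : 2 ^ (d - k) = 2 * 2 ^ (d - (k + 1)) := by
      rw [← pow_succ']
      congr 1
      omega
    have hmul := Submodule.mul_mem_mul (hα (2 * a) (by omega) x) (hα (2 * a + 1) (by omega) x)
    rw [Submodule.span_mul_span] at hmul
    rw [block]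
    refine Submodule.span_le.2 ?_ hmul
    rintro _ ⟨_, ⟨u, rfl⟩, _, ⟨v, rfl⟩, rfl⟩
    refine Submodule.span_mono ?_ (hp a t (ht a (Finset.mem_range.2 ha)) u v)
    rintro _ ⟨c, hc, rfl⟩
    simp only [Set.mem_Iio] at hc
    refine ⟨w ^ c, ?_⟩
    simp only [block, curve_succ_node hwK _ k _ (show c < R * R + 1 by omega),
      Function.update_self, hcur]
    congr 1
    · refine block_congr M k _ fun b hb => ?_
      have : shift R b k c = c / R := by
        rw [shift, hb, if_pos (by omega), Nat.mod_one, add_zero]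
      rw [this]
    · refine block_congr M k _ fun b hb => ?_
      have : shift R b k c = c / R + c % R := by
        rw [shift, hb, if_neg (by omega)]
      rw [this]

/-- The coordinates are replaced one at a time; fixing the others leaves a nonzero polynomial of
degree at most m < #s, so only the separate degrees matter. -/
theorem exists_forall_mem_ne_zero {m d : ℕ} {f : (ℕ → E) → E}
    (hf : ∀ α j, IsPolyMap m (fun t => f (Function.update α j t))) (s : Finset E) (hs : m < #s)
    {α : ℕ → E} (hα : f α ≠ 0) : ∃ α' : ℕ → E, (∀ j < d, α' j ∈ s) ∧ f α' ≠ 0 := by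
  induction d with
  | zero => exact ⟨α, by simp, hα⟩
  | succ d ih =>
    obtain ⟨α', h1, h2⟩ := ih
    obtain ⟨t, ht, hne⟩ := (hf α' d).exists_mem_ne_zero (t₀ := α' d)
      (by rwa [Function.update_eq_self]) s hs
    refine ⟨Function.update α' d t, fun j hj => ?_, hne⟩
    rcases eq_or_ne j d with rfl | h
    · rwa [Function.update_self]
    · rw [Function.update_of_ne h]
      exact h1 j (by omega)

/-- A nonzero linear functional of a product of `2 ^ d` univariate factors does not vanish at some
point of the curve of level `d` whose seeds and parameter are powers of `w`. -/
theorem exists_powers_block_ne_zero [Infinite E] [FiniteDimensional E A] {R L δ d : ℕ}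
    (hR : Module.finrank E A ≤ R) (hR1 : 1 ≤ R) {w : E}
    (hw : Set.InjOn (fun j => w ^ j) (Set.Iio L)) (hL : R * R + 1 ≤ L)
    (hd : 2 ^ d * (δ * (R * R)) < L) {M : ℕ → E → A} (hM : ∀ b, IsPolyMap δ (M b))
    (φ : A →ₗ[E] E) {x : ℕ → E} (hx : φ (block M d 0 x) ≠ 0) :
    ∃ g : ℕ → ℕ, (∀ j < d + 1, g j < L) ∧
      φ (block M d 0 fun b => curve w (R * R + 1) R (fun j => w ^ g j) d b (w ^ g d)) ≠ 0 := by
  classical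
  obtain ⟨α, hα⟩ := exists_seeds_span_curve hR hR1 hw hL hd hM d le_rfl
  obtain ⟨u, hu⟩ : ∃ u, φ (block M d 0 fun b => curve w (R * R + 1) R α d b u) ≠ 0 := by
    by_contra! h
    refine hx ?_
    have hle : Submodule.span E (Set.range fun u => block M d 0
        (fun b => curve w (R * R + 1) R α d b u)) ≤ φ.ker := by
      refine Submodule.span_le.2 ?_
      rintro _ ⟨u, rfl⟩
      exact h u
    exact hle (hα 0 (by positivity) x)
  let f : (ℕ → E) → E := fun α => φ (block M d 0 fun b => curve w (R * R + 1) R α d b (α d))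
  have hf : ∀ α j, IsPolyMap (2 ^ d * (δ * (R * R))) (fun t => f (Function.update α j t)) :=
    fun α j => (isPolyMap_block hM d 0 fun b => isPolyMap_curve_update α d b j).map φ
  have hfα : f (Function.update α d u) ≠ 0 := by
    have : ∀ b, curve w (R * R + 1) R (Function.update α d u) d b =
        curve w (R * R + 1) R α d b := fun b =>
      curve_congr d b fun i hi => Function.update_of_ne hi.ne _ _
    simpa only [f, this, Function.update_self] using hu
  have hcard : #((range L).image fun j => w ^ j) = L := by
    rw [Finset.card_image_of_injOn, Finset.card_range]
    simpa using hw
  obtain ⟨α', h1, h2⟩ := exists_forall_mem_ne_zero (d := d + 1) hf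
    ((range L).image fun j => w ^ j) (by omega) hfα
  have h3 : ∀ j, ∃ i, j < d + 1 → i < L ∧ w ^ i = α' j := by
    intro j
    by_cases hj : j < d + 1
    · obtain ⟨i, hi, hij⟩ := Finset.mem_image.1 (h1 j hj)
      exact ⟨i, fun _ => ⟨Finset.mem_range.1 hi, hij⟩⟩
    · exact ⟨0, fun h => absurd h hj⟩
  choose g hg using h3
  refine ⟨g, fun j hj => (hg j hj).1, ?_⟩
  have h4 : ∀ b, curve w (R * R + 1) R (fun j => w ^ g j) d b =
      curve w (R * R + 1) R α' d b := fun b =>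
    curve_congr d b fun i hi => (hg i (by omega)).2
  simp only [h4, (hg d (by omega)).2]
  exact h2

end Block

/-! ### Branching programs as matrix products -/

section TransferMatrix

open Finset

/-- Multiplying by the prefix before the block turns the recursion into a telescoping product. -/
theorem mul_block {E A : Type*} [Ring A] (M : ℕ → E → A) (x : ℕ → E) (k a : ℕ) :
    ((List.range (a * 2 ^ k)).map fun b => M b (x b)).prod * block M k a x =
      ((List.range ((a + 1) * 2 ^ k)).map fun b => M b (x b)).prod := by
  induction k generalizing a with
  | zero => simp [block, List.range_succ]
  | succ k ih =>
    rw [block, show a * 2 ^ (k + 1) = (2 * a) * 2 ^ k by ring, ← mul_assoc, ih, ih]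
    congr 3
    ring

theorem block_zero_eq_prod {E A : Type*} [Ring A] (M : ℕ → E → A) (x : ℕ → E) (k : ℕ) :
    block M k 0 x = ((List.range (2 ^ k)).map fun b => M b (x b)).prod := by
  simpa using mul_block M x k 0

theorem prod_range_eq_of_one {A : Type*} [Monoid A] {f : ℕ → A} {m k : ℕ} (h : m ≤ k)
    (hf : ∀ b, m ≤ b → f b = 1) :
    ((List.range k).map f).prod = ((List.range m).map f).prod := by
  induction k, h using Nat.le_induction with
  | base => rfl
  | succ k hk ih => simp [List.range_succ, ih, hf k hk]

/-- The arbitrary weight g on the last vertex is what the induction needs: it absorbs the last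
matrix when the last vertex is summed out. -/
theorem sum_prod_mul_eq {E ι : Type*} [CommRing E] [Fintype ι] [DecidableEq ι]
    (f : ℕ → Matrix ι ι E) (m : ℕ) (g : ι → E) :
    ∑ v : Fin (m + 1) → ι, (∏ i : Fin m, f i (v i.castSucc) (v i.succ)) * g (v (Fin.last m)) =
      ∑ a, ∑ b, ((List.range m).map f).prod a b * g b := by
  induction m generalizing g with
  | zero =>
    rw [← (Equiv.funUnique (Fin 1) ι).symm.sum_comp]
    simp [Matrix.one_apply]
  | succ m ih =>
    rw [← (Fin.snocEquiv fun _ : Fin (m + 2) => ι).sum_comp, Fintype.sum_prod_type,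
      Finset.sum_comm]
    have h1 : ∀ (v : Fin (m + 1) → ι) (e : ι),
        (∏ i : Fin (m + 1), f i ((Fin.snocEquiv fun _ : Fin (m + 2) => ι) (e, v) i.castSucc)
          ((Fin.snocEquiv fun _ : Fin (m + 2) => ι) (e, v) i.succ)) *
          g ((Fin.snocEquiv fun _ : Fin (m + 2) => ι) (e, v) (Fin.last (m + 1))) =
        (∏ i : Fin m, f i (v i.castSucc) (v i.succ)) * (f m (v (Fin.last m)) e * g e) := by
      intro v e
      rw [Fin.prod_univ_castSucc, ← mul_assoc]
      simp only [Fin.snocEquiv_apply, Fin.snoc_castSucc, Fin.succ_castSucc, Fin.succ_last,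
        Fin.snoc_last, Fin.val_castSucc, Fin.val_last]
    simp only [h1, ← Finset.mul_sum]
    rw [ih fun a => ∑ e, f m a e * g e]
    refine Finset.sum_congr rfl fun a _ => ?_
    simp only [List.range_succ, List.map_append, List.prod_append, List.map_cons, List.map_nil,
      List.prod_singleton, Matrix.mul_apply, Finset.sum_mul, Finset.mul_sum]
    rw [Finset.sum_comm]
    simp only [mul_assoc]

end TransferMatrix

namespace IsPolyMap

theorem matrix {E ι : Type*} [Field E] {m : ℕ} {g : E → Matrix ι ι E}
    (h : ∀ u v, IsPolyMap m (fun t => g t u v)) : IsPolyMap m g := by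
  choose a ha using h
  refine ⟨fun i => Matrix.of fun u v => a u v i, fun t => ?_⟩
  ext u v
  rw [Matrix.sum_apply]
  exact ha u v t

theorem aeval {F E : Type*} [Field F] [Field E] [Algebra F E] {n : ℕ} (hn : 1 ≤ n)
    {p : Polynomial F} (hp : p.degree < n) :
    IsPolyMap (n - 1) (fun t : E => Polynomial.aeval t p) := by
  have hp' : p.natDegree < n := by
    rcases eq_or_ne p 0 with rfl | h
    · simp only [Polynomial.natDegree_zero]
      omega
    · exact (Polynomial.natDegree_lt_iff_degree_lt h).2 hp
  refine ⟨fun i => algebraMap F E (p.coeff i), fun t => ?_⟩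
  change Polynomial.aeval t p = _
  rw [Polynomial.aeval_eq_sum_range' hp', Nat.sub_add_cancel hn]
  refine Finset.sum_congr rfl fun i _ => ?_
  rw [Algebra.smul_def, smul_eq_mul, mul_comm]

end IsPolyMap

namespace ROABP

variable {F : Type*} [Field F] {D : ℕ}

open Classical in
/-- The transfer matrix from level `b` to level `b + 1` of a program of width at most `r`, with the
variable `x_b` evaluated at a point of an extension field; the identity beyond the last level. -/
noncomputable def transfer (A : ROABP F D) (r : ℕ) {E : Type*} [Field E] [Algebra F E] (b : ℕ)
    (t : E) : Matrix (Fin r) (Fin r) E :=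
  if hb : b < D then
    Matrix.of fun u v =>
      if h : (u : ℕ) < A.size (Fin.castSucc ⟨b, hb⟩) ∧ (v : ℕ) < A.size (Fin.succ ⟨b, hb⟩) then
        if (⟨u, h.1⟩, ⟨v, h.2⟩) ∈ A.edges ⟨b, hb⟩ then
          Polynomial.aeval t (A.label ⟨b, hb⟩ ⟨u, h.1⟩ ⟨v, h.2⟩)
        else 0
      else 0
  else 1

theorem isPolyMap_transfer (A : ROABP F D) {n r : ℕ} (hn : 1 ≤ n) (hA : A.DegreeLT n)
    {E : Type*} [Field E] [Algebra F E] (b : ℕ) :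
    IsPolyMap (n - 1) (A.transfer r (E := E) b) := by
  by_cases hb : b < D
  · refine IsPolyMap.matrix fun u v => ?_
    simp only [transfer, dif_pos hb, Matrix.of_apply]
    split_ifs with h h'
    · exact IsPolyMap.aeval hn (hA _ _ h')
    · exact IsPolyMap.const _ _
    · exact IsPolyMap.const _ _
  · have : A.transfer r (E := E) b = fun _ => 1 := by
      funext t
      rw [transfer, dif_neg hb]
    rw [this]
    exact IsPolyMap.const _ _

/-- A tuple of indices below r that is not a path meets a zero entry, so summing over all entries of
the product is harmless; no entry for the source and the sink has to be singled out. -/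
theorem aeval_poly_eq (A : ROABP F D) {r : ℕ} (hD : 1 ≤ D) (hA : A.WidthLE r) {E : Type*}
    [Field E] [Algebra F E] (x : ℕ → E) :
    MvPolynomial.aeval (fun i : Fin D => x i) A.poly =
      ∑ u, ∑ v, ((List.range D).map fun b => A.transfer r b (x b)).prod u v := by
  classical
  have h := sum_prod_mul_eq (fun b => A.transfer r b (x b)) D (fun _ => 1)
  simp only [mul_one] at h
  rw [← h, poly, map_sum]
  have hentry : ∀ (i : Fin D) (u : Fin (A.size i.castSucc)) (v : Fin (A.size i.succ)),
      (u, v) ∈ A.edges i → A.transfer r i (x i) ⟨u, u.2.trans_le (hA _)⟩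
        ⟨v, v.2.trans_le (hA _)⟩ = Polynomial.aeval (x i) (A.label i u v) := by
    intro i u v huv
    simp only [transfer, dif_pos i.2, Matrix.of_apply]
    rw [dif_pos ⟨u.2, v.2⟩, if_pos huv]
  refine Finset.sum_bij_ne_zero (fun v _ _ i => ⟨v i, (v i).2.trans_le (hA i)⟩) ?_ ?_ ?_ ?_
  · intro v _ _
    exact Finset.mem_univ _
  · intro v _ _ v' _ _ hvv
    funext i
    have := congrFun hvv i
    simpa [Fin.ext_iff] using this
  · intro v _ hv
    have hne : ∀ i : Fin D, A.transfer r i (x i) (v i.castSucc) (v i.succ) ≠ 0 := fun i =>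
      Finset.prod_ne_zero_iff.1 hv i (Finset.mem_univ i)
    have hedge : ∀ i : Fin D, ∃ h : (v i.castSucc : ℕ) < A.size i.castSucc ∧
        (v i.succ : ℕ) < A.size i.succ, (⟨_, h.1⟩, ⟨_, h.2⟩) ∈ A.edges i := by
      intro i
      have := hne i
      simp only [transfer, dif_pos i.2, Matrix.of_apply] at this
      by_contra! hcon
      refine this ?_
      split_ifs with h1 h2
      · exact absurd h2 (hcon h1)
      · rfl
      · rfl
    have hsize : ∀ i, (v i : ℕ) < A.size i := by
      intro i
      -- A vertex below the last level is bounded by its outgoing edge, one on the last level by its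
      -- incoming edge, which exists because D ≥ 1.
      refine Fin.lastCases ?_ (fun i => (hedge i).1.1) i
      have := (hedge ⟨D - 1, by omega⟩).1.2
      have hl : Fin.succ (⟨D - 1, by omega⟩ : Fin D) = Fin.last D := by
        ext
        simp
        omega
      rwa [hl] at this
    refine ⟨fun i => ⟨v i, hsize i⟩, ?_, ?_, rfl⟩
    · simp only [paths, Finset.mem_filter, Finset.mem_univ, true_and]
      exact fun i => (hedge i).2
    · rw [map_prod]
      refine Finset.prod_ne_zero_iff.2 fun i _ => ?_
      rw [← Polynomial.aeval_algHom_apply, MvPolynomial.aeval_X, ← hentry i _ _ (hedge i).2]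
      exact hne i
  · intro v hv _
    rw [map_prod]
    refine Finset.prod_congr rfl fun i _ => ?_
    simp only [paths, Finset.mem_filter, Finset.mem_univ, true_and] at hv
    rw [← Polynomial.aeval_algHom_apply, MvPolynomial.aeval_X, ← hentry i _ _ (hv i)]

end ROABP

/-! ### The hitting set over the base field -/

section Grid

variable {F : Type*} [Field F]

/-- The `i`-th point of the hitting set: the digits of `i` in base `L` are the exponents of the
seeds and of the parameter of the curve of level `⌈lg D⌉`. -/
noncomputable def gridPoint (w : F) (D R L i b : ℕ) : F :=
  curve w (R * R + 1) R (fun j => w ^ (i / L ^ j % L)) (Nat.clog 2 D) b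
    (w ^ (i / L ^ Nat.clog 2 D % L))

/-- A nonzero polynomial is nonzero at some point over the algebraic closure; the curve argument
there yields exponents of w, hence a grid point over F at which it is still nonzero. -/
theorem isHittingSet_gridPoint {D n r L : ℕ} (hD : 1 ≤ D) (hn : 1 ≤ n) (hr : 1 ≤ r)
    (hL : L = 2 * D * n * (r * r * (r * r))) {w : F}
    (hw : Set.InjOn (fun j => w ^ j) (Set.Iio L)) :
    IsHittingSet (roabpClass F D n r)
      (Set.range fun (i : Fin (L ^ (Nat.clog 2 D + 1))) (b : Fin D) =>
        gridPoint w D (r * r) L i b) := by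
  classical
  rintro _ ⟨A, hwidth, hdeg, rfl⟩
  refine ⟨fun h x _ => by rw [h, map_zero], fun h => ?_⟩
  by_contra hne
  let E := AlgebraicClosure F
  have hE : Infinite E := IsAlgClosed.instInfinite
  let σ : F →+* E := algebraMap F E
  obtain ⟨x, hx⟩ : ∃ x : Fin D → E, MvPolynomial.aeval x A.poly ≠ 0 := by
    by_contra! hcon
    refine hne (MvPolynomial.map_injective σ σ.injective ?_)
    rw [map_zero]
    refine MvPolynomial.funext fun x => ?_
    rw [MvPolynomial.eval_map, map_zero]
    exact hcon x
  have hR0 : 1 ≤ r * r * (r * r) := Nat.one_le_iff_ne_zero.2 (by positivity)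
  have hDn : 1 ≤ D * n := by nlinarith
  -- Padding to a power of two less than doubles the number of factors; this is the factor 2 in L.
  have hpow : 2 ^ Nat.clog 2 D < 2 * D := by
    rcases hD.eq_or_lt with rfl | hD'
    · simp
    · have h1 := Nat.pow_pred_clog_lt_self (b := 2) (by norm_num) hD'
      have h2 : 1 ≤ Nat.clog 2 D := Nat.clog_pos (by norm_num) hD'
      obtain ⟨c, hc⟩ := Nat.exists_eq_add_of_le' h2
      rw [hc] at h1 ⊢
      rw [Nat.pred_eq_sub_one, Nat.add_sub_cancel] at h1
      rw [pow_succ]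
      omega
  have hL1 : r * r * (r * r) + 1 ≤ L := by
    rw [hL]
    nlinarith
  have hL2 : 2 ^ Nat.clog 2 D * ((n - 1) * (r * r * (r * r))) < L := by
    rw [hL]
    calc 2 ^ Nat.clog 2 D * ((n - 1) * (r * r * (r * r)))
        ≤ 2 ^ Nat.clog 2 D * (n * (r * r * (r * r))) := by gcongr; omega
      _ < 2 * D * (n * (r * r * (r * r))) := by gcongr
      _ = _ := by ring
  have hclog : D ≤ 2 ^ Nat.clog 2 D := Nat.le_pow_clog (by norm_num) D
  have hsw : Set.InjOn (fun j => σ w ^ j) (Set.Iio L) := by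
    intro i hi j hj hij
    exact hw hi hj (σ.injective (by simpa using hij))
  let φ : Matrix (Fin r) (Fin r) E →ₗ[E] E :=
    ∑ u, ∑ v, Matrix.entryLinearMap E E u v
  have hφ : ∀ y : ℕ → E, φ (block (fun b => A.transfer r (E := E) b) (Nat.clog 2 D) 0 y) =
      MvPolynomial.aeval (fun i : Fin D => y i) A.poly := by
    intro y
    rw [A.aeval_poly_eq hD hwidth, block_zero_eq_prod,
      prod_range_eq_of_one (f := fun b => A.transfer r b (y b)) hclog]
    · simp [φ, LinearMap.sum_apply, Matrix.entryLinearMap_apply]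
    · intro b hb
      rw [ROABP.transfer, dif_neg (by omega)]
  have hx' : φ (block (fun b => A.transfer r (E := E) b) (Nat.clog 2 D) 0
      (fun b => if h : b < D then x ⟨b, h⟩ else 0)) ≠ 0 := by
    rw [hφ]
    simpa using hx
  obtain ⟨g, hg, hne'⟩ := exists_powers_block_ne_zero (R := r * r) (by simp [Module.finrank_matrix]) (by nlinarith)
    hsw hL1 hL2 (fun b => A.isPolyMap_transfer hn hdeg b) φ hx'
  -- The exponents are the base-L digits of the index of the point.
  let i : Fin (L ^ (Nat.clog 2 D + 1)) := finFunctionFinEquiv fun j => ⟨g j, hg j j.2⟩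
  have hi : ∀ j < Nat.clog 2 D + 1, (i : ℕ) / L ^ j % L = g j := by
    intro j hj
    have := finFunctionFinEquiv_symm_apply_val i ⟨j, hj⟩
    rw [← this]
    simp [i]
  have h0 := h _ ⟨i, rfl⟩
  refine hne' ?_
  rw [hφ]
  have hpt : (fun b : Fin D => curve (σ w) (r * r * (r * r) + 1) (r * r) (fun j => σ w ^ g j)
      (Nat.clog 2 D) b (σ w ^ g (Nat.clog 2 D))) =
      fun b : Fin D => σ (gridPoint w D (r * r) L i b) := by
    funext b
    rw [gridPoint, map_curve, map_pow, hi _ (Nat.lt_succ_self _)]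
    refine congrFun (curve_congr _ _ fun j hj => ?_) _
    rw [map_pow, hi j (by omega)]
  rw [hpt]
  have hev : ∀ y : Fin D → F, MvPolynomial.aeval (fun b => σ (y b)) A.poly =
      σ (MvPolynomial.eval y A.poly) := fun y => by
    rw [MvPolynomial.aeval_def, MvPolynomial.eval, MvPolynomial.coe_eval₂Hom,
      MvPolynomial.hom_eval₂]
    rfl
  rw [hev, h0, map_zero]

end Grid

/-! ### Elements of large multiplicative order -/

section Order

open Finset

variable {F : Type*} [Field F]

/-- `x` is a unit of order at least `L`. -/
def HasOrderGE (L : ℕ) (x : F) : Prop := x ≠ 0 ∧ ∀ j, 1 ≤ j → j < L → x ^ j ≠ 1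

theorem HasOrderGE.injOn {L : ℕ} {x : F} (hx : HasOrderGE L x) :
    Set.InjOn (fun j => x ^ j) (Set.Iio L) := by
  have key : ∀ i j, i < j → j < L → x ^ i ≠ x ^ j := by
    intro i j hij hj h
    refine hx.2 (j - i) (by omega) (by omega) ?_
    rw [pow_sub₀ _ hx.1 hij.le, ← h, mul_inv_cancel₀ (pow_ne_zero _ hx.1)]
  intro i hi j hj hij
  rcases lt_trichotomy i j with h | h | h
  · exact absurd hij (key i j h hj)
  · exact h
  · exact absurd hij.symm (key j i h hi)

/-- Zero and the roots of X^j = 1, 1 ≤ j < L, are at most L² elements, so L² + 1 distinct ones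
contain a good element. If F has fewer elements, all are listed within the bound, among them a
generator of the cyclic group of units, whose order is |F| - 1 ≥ L. -/
theorem exists_hasOrderGE {e : ℕ → F} (he : IsEnumeration e) {L : ℕ} (hL : 1 ≤ L)
    (hF : (L : ℕ∞) < ENat.card F) : ∃ k < L * L + 1, HasOrderGE L (e k) := by
  classical
  rcases le_or_gt ((L * L + 1 : ℕ) : ℕ∞) (ENat.card F) with h | h
  · let bad : Finset F := insert 0 ((Ico 1 L).biUnion fun j => (Polynomial.nthRoots j (1 : F)).toFinset)
    have hbad : #bad ≤ L * L := by
      refine (Finset.card_insert_le _ _).trans ?_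
      have h1 := Finset.card_biUnion_le_card_mul (Ico 1 L)
        (fun j => (Polynomial.nthRoots j (1 : F)).toFinset) L fun j hj =>
          (Multiset.toFinset_card_le _).trans ((Polynomial.card_nthRoots j 1).trans
            (Finset.mem_Ico.1 hj).2.le)
      rw [Nat.card_Ico] at h1
      have h2 : (L - 1) * L + L = L * L := by
        rw [← Nat.succ_mul]
        congr 1
        omega
      omega
    have hcard : #((range (L * L + 1)).image e) = L * L + 1 := by
      rw [Finset.card_image_of_injOn, Finset.card_range]
      refine he.mono fun k hk => ?_
      simp only [Finset.coe_range, Set.mem_Iio, Set.mem_ofPred_eq] at hk ⊢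
      exact lt_of_lt_of_le (by exact_mod_cast hk) h
    obtain ⟨x, hx, hxb⟩ := Finset.exists_mem_notMem_of_card_lt_card
      (show #bad < #((range (L * L + 1)).image e) by omega)
    obtain ⟨k, hk, rfl⟩ := Finset.mem_image.1 hx
    refine ⟨k, Finset.mem_range.1 hk, fun h0 => hxb (by simp [bad, h0]), fun j h1 h2 h3 => hxb ?_⟩
    refine Finset.mem_insert_of_mem (Finset.mem_biUnion.2 ⟨j, Finset.mem_Ico.2 ⟨h1, h2⟩, ?_⟩)
    rw [Multiset.mem_toFinset, Polynomial.mem_nthRoots h1]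
    exact h3
  · have hfin : Finite F := by
      rw [← ENat.card_lt_top]
      exact h.trans_le le_top
    have := Fintype.ofFinite F
    rw [ENat.card_eq_coe_fintype_card] at h hF
    have h' : Fintype.card F < L * L + 1 := by exact_mod_cast h
    have hF' : L < Fintype.card F := by exact_mod_cast hF
    have hinj : Function.Injective fun k : Fin (Fintype.card F) => e k := by
      intro k k' hkk
      have hlt : ∀ k : Fin (Fintype.card F), ((k : ℕ) : ℕ∞) < ENat.card F := fun k => by
        rw [ENat.card_eq_coe_fintype_card]
        exact_mod_cast k.2
      exact Fin.ext (he (hlt k) (hlt k') hkk)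
    have hsurj := ((Fintype.bijective_iff_injective_and_card _).2 ⟨hinj, by simp⟩).2
    obtain ⟨g, hg⟩ := IsCyclic.exists_generator (α := Fˣ)
    obtain ⟨k, hk⟩ := hsurj (g : F)
    refine ⟨k, k.2.trans h', ?_⟩
    simp only at hk
    rw [hk]
    refine ⟨g.ne_zero, fun j h1 h2 h3 => ?_⟩
    have hord : orderOf g = Fintype.card F - 1 := by
      rw [orderOf_eq_card_of_forall_mem_zpowers hg, Nat.card_eq_fintype_card, Fintype.card_units]
    have hg1 : g ^ j = 1 := Units.ext (by simpa using h3)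
    have := Nat.le_of_dvd h1 (orderOf_dvd_of_pow_eq_one hg1)
    omega

end Order

/-! ### Reasoning about running times and memory -/

section Framework

variable {F : Type*} [Field F] {e : ℕ → F}

namespace State

/-- Write `v` to address `a` of the memory of natural numbers. -/
def setNat (s : State F) (a v : ℕ) : State F := { s with nat := Function.update s.nat a v }

/-- Write `x` to address `a` of the field memory. -/
def setFld (s : State F) (a : ℕ) (x : F) : State F := { s with fld := Function.update s.fld a x }

omit [Field F] in
@[simp] theorem setNat_nat (s : State F) (a v b : ℕ) :
    (s.setNat a v).nat b = if b = a then v else s.nat b := by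
  simp [setNat, Function.update_apply]

omit [Field F] in
@[simp] theorem setNat_fld (s : State F) (a v : ℕ) : (s.setNat a v).fld = s.fld := rfl

omit [Field F] in
@[simp] theorem setFld_fld (s : State F) (a : ℕ) (x : F) (b : ℕ) :
    (s.setFld a x).fld b = if b = a then x else s.fld b := by
  simp [setFld, Function.update_apply]

omit [Field F] in
@[simp] theorem setFld_nat (s : State F) (a : ℕ) (x : F) : (s.setFld a x).nat = s.nat := rfl

end State

/-- Started in `s`, the program `P` halts after at most `T` steps in a state that satisfies `Q`. -/
def Runs (e : ℕ → F) (P : Prog) (s : State F) (T : ℕ) (Q : State F → Prop) : Prop :=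
  ∃ (t : ℕ) (s' : State F), t ≤ T ∧ Exec e P s t s' ∧ Q s'

namespace Runs

variable {P P' : Prog} {s : State F} {T T' T₁ T₂ : ℕ} {Q Q' : State F → Prop}

theorem mono (h : Runs e P s T Q) (hT : T ≤ T') (hQ : ∀ s', Q s' → Q' s') : Runs e P s T' Q' := by
  obtain ⟨t, s', h1, h2, h3⟩ := h
  exact ⟨t, s', h1.trans hT, h2, hQ s' h3⟩

theorem skip (hT : 1 ≤ T) (hQ : Q s) : Runs e Prog.skip s T Q :=
  ⟨1, s, hT, Exec.skip s, hQ⟩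

theorem setN {a b : NExp} (hT : a.cost + b.cost + 1 ≤ T) (hQ : Q (s.setNat (a.eval s) (b.eval s))) :
    Runs e (Prog.setN a b) s T Q :=
  ⟨_, _, hT, Exec.setN a b s, hQ⟩

theorem setF {a : NExp} {x : FExp} (hT : a.cost + x.cost + 1 ≤ T)
    (hQ : Q (s.setFld (a.eval s) (x.eval s))) : Runs e (Prog.setF a x) s T Q :=
  ⟨_, _, hT, Exec.setF a x s, hQ⟩

theorem enum {a k : NExp} (hT : a.cost + k.cost + (k.eval s + 1) ≤ T)
    (hQ : Q (s.setFld (a.eval s) (e (k.eval s)))) : Runs e (Prog.enum a k) s T Q :=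
  ⟨_, _, hT, Exec.enum a k s, hQ⟩

theorem seq (h : Runs e P s T₁ fun s' => Runs e P' s' T₂ Q) (hT : T₁ + T₂ ≤ T) :
    Runs e (Prog.seq P P') s T Q := by
  obtain ⟨t, s', h1, h2, t', s'', h3, h4, h5⟩ := h
  exact ⟨t + t', s'', by omega, Exec.seq h2 h4, h5⟩

theorem ite {c : Test} (h₁ : c.Holds s → Runs e P s T Q) (h₂ : ¬ c.Holds s → Runs e P' s T Q)
    (hT : c.cost + T ≤ T') : Runs e (Prog.ite c P P') s T' Q := by
  by_cases hc : c.Holds s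
  · obtain ⟨t, s', h1, h2, h3⟩ := h₁ hc
    exact ⟨c.cost + t, s', by omega, Exec.ite_true hc h2, h3⟩
  · obtain ⟨t, s', h1, h2, h3⟩ := h₂ hc
    exact ⟨c.cost + t, s', by omega, Exec.ite_false hc h2, h3⟩

theorem loop {c : Test} (Inv : ℕ → State F → Prop) {N : ℕ} (h₀ : Inv 0 s)
    (hstep : ∀ j < N, ∀ s, Inv j s → c.Holds s ∧ Runs e P s T (Inv (j + 1)))
    (hend : ∀ s, Inv N s → ¬ c.Holds s) :
    Runs e (Prog.loop c P) s (N * (T + c.cost) + c.cost) (Inv N) := by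
  have key : ∀ k j s, j + k = N → Inv j s →
      Runs e (Prog.loop c P) s (k * (T + c.cost) + c.cost) (Inv N) := by
    intro k
    induction k with
    | zero =>
      intro j s hj hs
      obtain rfl : j = N := by omega
      exact ⟨_, s, by omega, Exec.loop_false (hend s hs), hs⟩
    | succ k ih =>
      intro j s hj hs
      obtain ⟨hc, t, s', h1, h2, h3⟩ := hstep j (by omega) s hs
      obtain ⟨t', s'', h4, h5, h6⟩ := ih (j + 1) s' (by omega) h3
      refine ⟨_, s'', ?_, Exec.loop_true hc h2 h5, h6⟩
      rw [add_mul, one_mul]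
      omega
  exact key N 0 s (by omega) h₀

end Runs

/-- The natural number at address `a`. -/
abbrev reg (a : ℕ) : NExp := NExp.load (NExp.const a)

/-- Write the natural number `b` to address `a`. -/
abbrev assign (a : ℕ) (b : NExp) : Prog := Prog.setN (NExp.const a) b

/-- For `j = 0, …, m - 1`: with the counter `j` at address `i`, execute `P`. -/
def forLoop (i : ℕ) (m : NExp) (P : Prog) : Prog :=
  Prog.seq (assign i (NExp.const 0))
    (Prog.loop (Test.le (NExp.add (reg i) (NExp.const 1)) m)
      (Prog.seq P (assign i (NExp.add (reg i) (NExp.const 1)))))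

/-- All times are measured in powers of one L, so that bounds compose under nesting. The slack N ≤ 2
L^p admits counts such as L + L and L² + 1. The 45 is 2 · 16 for the overhead of the at most 2 L^p
rounds plus 13 for the initialization and the last test. -/
theorem Runs.forLoop {i : ℕ} {m : NExp} {P : Prog} {s : State F} (Inv : ℕ → State F → Prop)
    {N c j p L : ℕ} (hL : 1 ≤ L) (hN : N ≤ 2 * L ^ p) (hm : m.cost ≤ 5) (h₀ : Inv 0 s)
    (hi : ∀ k s v, Inv k s → Inv k (s.setNat i v))
    (hN' : ∀ k s, Inv k s → m.eval s = N)
    (hstep : ∀ k < N, ∀ s, s.nat i = k → Inv k s →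
      Runs e P s (c * L ^ j) (fun s' => s'.nat i = k ∧ Inv (k + 1) s')) :
    Runs e (forLoop i m P) s ((2 * c + 45) * L ^ (j + p)) (Inv N) := by
  refine Runs.seq (T₁ := 3)
    (T₂ := N * (c * L ^ j + 6 + (m.cost + 5)) + (m.cost + 5)) (Runs.setN le_rfl ?_) ?_
  · refine (Runs.loop (T := c * L ^ j + 6) (fun k s => s.nat i = k ∧ Inv k s) (N := N)
      ?_ ?_ ?_).mono ?_ fun s h => h.2
    · exact ⟨by simp [NExp.eval], hi _ _ _ h₀⟩
    · rintro k hk s ⟨h1, h2⟩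
      refine ⟨?_, ?_⟩
      · simp only [Test.Holds, NExp.eval, hN' k s h2, h1]
        omega
      · refine Runs.seq ((hstep k hk s h1 h2).mono le_rfl fun s' hs' => ?_) le_rfl
        refine Runs.setN le_rfl ⟨?_, hi _ _ _ hs'.2⟩
        simp [NExp.eval, hs'.1]
    · rintro s ⟨h1, h2⟩
      simp only [Test.Holds, NExp.eval, hN' N s h2, h1]
      omega
    · simp only [Test.cost, NExp.cost]
      have : 2 + 1 + 1 + m.cost + 1 = m.cost + 5 := by ring
      simp only [show 1 + 1 + 1 + 1 + m.cost + 1 = m.cost + 5 by ring]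
      rfl
  · have h1 : N * (c * L ^ j + 6 + (m.cost + 5)) ≤ 2 * L ^ p * (c * L ^ j + 16) :=
      Nat.mul_le_mul hN (by omega)
    have h2 : 1 ≤ L ^ j := Nat.one_le_pow _ _ hL
    have h3 : 1 ≤ L ^ p := Nat.one_le_pow _ _ hL
    rw [pow_add]
    nlinarith [Nat.mul_le_mul h2 h3, Nat.mul_le_mul_right (L ^ p) h2]

/-- The states `s` and `s'` agree below address `θ` of the first memory and below address `φ` of
the second memory. -/
structure Frame (θ φ : ℕ) (s s' : State F) : Prop where
  nat : ∀ a < θ, s'.nat a = s.nat a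
  fld : ∀ a < φ, s'.fld a = s.fld a

namespace Frame

omit [Field F]

variable {θ φ θ' φ' : ℕ} {s s' s'' : State F}

theorem refl (s : State F) : Frame θ φ s s := ⟨fun _ _ => rfl, fun _ _ => rfl⟩

theorem trans (h : Frame θ φ s s') (h' : Frame θ φ s' s'') : Frame θ φ s s'' :=
  ⟨fun a ha => (h'.nat a ha).trans (h.nat a ha), fun a ha => (h'.fld a ha).trans (h.fld a ha)⟩

theorem mono (h : Frame θ φ s s') (h₁ : θ' ≤ θ) (h₂ : φ' ≤ φ) : Frame θ' φ' s s' :=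
  ⟨fun a ha => h.nat a (ha.trans_le h₁), fun a ha => h.fld a (ha.trans_le h₂)⟩

theorem setNat (h : Frame θ φ s s') {a : ℕ} (ha : θ ≤ a) (v : ℕ) :
    Frame θ φ s (s'.setNat a v) :=
  ⟨fun b hb => by rw [State.setNat_nat, if_neg (by omega), h.nat b hb], h.fld⟩

theorem setFld (h : Frame θ φ s s') {a : ℕ} (ha : φ ≤ a) (x : F) :
    Frame θ φ s (s'.setFld a x) :=
  ⟨h.nat, fun b hb => by rw [State.setFld_fld, if_neg (by omega), h.fld b hb]⟩

end Frame

end Framework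

/-! ### Evaluating Lagrange interpolation on the machine -/

section Interpolation

variable {F : Type*} [Field F] {e : ℕ → F}

/-- The address of the power of `w` whose exponent stands at address `a`. -/
abbrev powAddr (a : ℕ) : NExp := NExp.add (reg 0) (reg a)

/-- The address of the `k`-th auxiliary field element. -/
abbrev auxAddr (k : ℕ) : NExp := NExp.add (reg 10) (NExp.const k)

/-- The memory after the initialization: `D, i, R, K, L`, the base addresses of the arrays, and the
table of the powers of `w`. -/
structure Ready (D i R L : ℕ) (w : F) (s : State F) : Prop where
  nat0 : s.nat 0 = D
  nat3 : s.nat 3 = i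
  nat4 : s.nat 4 = R
  nat5 : s.nat 5 = R * R + 1
  nat6 : s.nat 6 = L
  nat8 : s.nat 8 = D + 2 * L
  nat9 : s.nat 9 = D + 2 * L + (R * R + 1)
  nat10 : s.nat 10 = D + 2 * L + 2 * (R * R + 1)
  table : ∀ j < 2 * L, s.fld (D + j) = w ^ j

theorem Ready.of_eq {D i R L : ℕ} {w : F} {s s' : State F} (h : Ready D i R L w s)
    (hn : ∀ a < 11, s'.nat a = s.nat a)
    (hf : ∀ a, D ≤ a → a < D + 2 * L → s'.fld a = s.fld a) : Ready D i R L w s' where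
  nat0 := (hn 0 (by norm_num)).trans h.nat0
  nat3 := (hn 3 (by norm_num)).trans h.nat3
  nat4 := (hn 4 (by norm_num)).trans h.nat4
  nat5 := (hn 5 (by norm_num)).trans h.nat5
  nat6 := (hn 6 (by norm_num)).trans h.nat6
  nat8 := (hn 8 (by norm_num)).trans h.nat8
  nat9 := (hn 9 (by norm_num)).trans h.nat9
  nat10 := (hn 10 (by norm_num)).trans h.nat10
  table j hj := (hf _ (by omega) (by omega)).trans (h.table j hj)

/-- Parameters occupy the low addresses and inner routines work at ever higher ones, so a frame
condition is enough to keep the parameters and the table intact. -/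
theorem Ready.of_frame {D i R L θ φ : ℕ} {w : F} {s s' : State F} (h : Ready D i R L w s)
    (hs : Frame θ φ s s') (hθ : 11 ≤ θ) (hφ : D + 2 * L ≤ φ) : Ready D i R L w s' :=
  h.of_eq (fun a ha => hs.nat a (by omega)) fun a _ ha => hs.fld a (by omega)

/-- Multiply the field element at `auxAddr 1` by the factors of a Lagrange basis polynomial; its
index stands at address `18`, the exponent of the point at address `17`. -/
def lagrProg : Prog :=
  forLoop 19 (reg 5)
    (Prog.ite (Test.eq (FExp.load (powAddr 18)) (FExp.load (powAddr 19))) Prog.skip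
      (Prog.setF (auxAddr 1) (FExp.mul (FExp.load (auxAddr 1))
        (FExp.mul (FExp.sub (FExp.load (powAddr 17)) (FExp.load (powAddr 19)))
          (FExp.inv (FExp.sub (FExp.load (powAddr 18)) (FExp.load (powAddr 19))))))))

theorem runs_lagrProg {D i R L x c : ℕ} {w : F} {s : State F} (hs : Ready D i R L w s)
    (hK : R * R + 1 ≤ L) (hx : s.nat 17 = x) (hxL : x < 2 * L) (hc : s.nat 18 = c)
    (hcL : c < R * R + 1) (h1 : s.fld (D + 2 * L + 2 * (R * R + 1) + 1) = 1) :
    Runs e lagrProg s (155 * L) fun s' =>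
      Frame 19 (D + 2 * L + 2 * (R * R + 1) + 1) s s' ∧
        s'.fld (D + 2 * L + 2 * (R * R + 1) + 1) = lagr w (R * R + 1) c (w ^ x) := by
  classical
  refine (Runs.forLoop (c := 55) (j := 0) (p := 1) (L := L) (N := R * R + 1) (fun k s' =>
      Frame 19 (D + 2 * L + 2 * (R * R + 1) + 1) s s' ∧
        s'.fld (D + 2 * L + 2 * (R * R + 1) + 1) = ∏ j ∈ Finset.range k,
          if w ^ c = w ^ j then 1 else (w ^ x - w ^ j) * (w ^ c - w ^ j)⁻¹)
    (by omega) (by rw [pow_one]; omega) (by simp [NExp.cost]) ?_ ?_ ?_ ?_).mono (by simp) fun s' h => h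
  · exact ⟨Frame.refl s, by simpa using h1⟩
  · rintro k s' v ⟨h2, h3⟩
    exact ⟨h2.setNat le_rfl v, h3⟩
  · rintro k s' ⟨h2, -⟩
    simp only [NExp.eval, (hs.of_frame h2 (by norm_num) (by omega)).nat5]
  · rintro k hk s' h19 ⟨h2, h3⟩
    have hr := hs.of_frame h2 (by norm_num) (by omega)
    have h17 : s'.nat 17 = x := (h2.nat 17 (by norm_num)).trans hx
    have h18 : s'.nat 18 = c := (h2.nat 18 (by norm_num)).trans hc
    have hwx := hr.table x hxL
    have hwc := hr.table c (by omega)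
    have hwk := hr.table k (by omega)
    refine Runs.ite (T := 40) (fun h => Runs.skip (by norm_num) ?_)
      (fun h => Runs.setF (by simp [NExp.cost, FExp.cost]) ?_) (by simp [Test.cost, FExp.cost, NExp.cost])
    · simp only [Test.Holds, FExp.eval, NExp.eval, hr.nat0, h18, h19, hwc, hwk] at h
      refine ⟨h19, h2, ?_⟩
      rw [Finset.prod_range_succ, if_pos h, mul_one, h3]
    · simp only [Test.Holds, FExp.eval, NExp.eval, hr.nat0, h18, h19, hwc, hwk] at h
      simp only [FExp.eval, NExp.eval, hr.nat0, h17, h18, h19, hwc, hwk, hwx, hr.nat10, h3]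
      refine ⟨by simpa using h19, h2.setFld le_rfl _, ?_⟩
      rw [Finset.prod_range_succ, if_neg h]
      simp

/-- Evaluate the interpolation polynomial of the array at address `8` at the power of `w` whose
exponent stands at address `17`; the result goes to `auxAddr 0`. -/
def interpProg : Prog :=
  Prog.seq (Prog.setF (auxAddr 0) FExp.zero)
    (forLoop 18 (reg 5)
      (Prog.seq (Prog.setF (auxAddr 1) FExp.one)
        (Prog.seq lagrProg
          (Prog.setF (auxAddr 0) (FExp.add (FExp.load (auxAddr 0))
            (FExp.mul (FExp.load (auxAddr 1)) (FExp.load (NExp.add (reg 8) (reg 18)))))))))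

theorem runs_interpProg {D i R L x : ℕ} {w : F} {v : ℕ → F} {s : State F}
    (hs : Ready D i R L w s) (hK : R * R + 1 ≤ L) (hx : s.nat 17 = x) (hxL : x < 2 * L)
    (hv : ∀ c < R * R + 1, s.fld (D + 2 * L + c) = v c) :
    Runs e interpProg s (500 * L ^ 2) fun s' =>
      Frame 18 (D + 2 * L + 2 * (R * R + 1)) s s' ∧
        s'.fld (D + 2 * L + 2 * (R * R + 1)) =
          ∑ c ∈ Finset.range (R * R + 1), lagr w (R * R + 1) c (w ^ x) * v c := by
  have hL2 : L ≤ L ^ 2 := Nat.le_self_pow (by norm_num) L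
  refine Runs.seq (T₁ := 10) (T₂ := 450 * L ^ 2) (Runs.setF (by simp [NExp.cost, FExp.cost]) ?_)
    (by omega)
  simp only [NExp.eval, FExp.eval, hs.nat10, add_zero]
  refine (Runs.forLoop (c := 200) (j := 1) (p := 1) (L := L) (N := R * R + 1) (fun k s' =>
      Frame 18 (D + 2 * L + 2 * (R * R + 1)) s s' ∧
        s'.fld (D + 2 * L + 2 * (R * R + 1)) = ∑ c ∈ Finset.range k,
          lagr w (R * R + 1) c (w ^ x) * v c)
    (by omega) (by rw [pow_one]; omega) (by simp [NExp.cost]) ?_ ?_ ?_ ?_).mono (by norm_num; omega) fun s' h => h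
  · exact ⟨(Frame.refl s).setFld le_rfl _, by simp⟩
  · rintro k s' v ⟨h2, h3⟩
    exact ⟨h2.setNat le_rfl v, h3⟩
  · rintro k s' ⟨h2, -⟩
    simp only [NExp.eval, (hs.of_frame h2 (by norm_num) (by omega)).nat5]
  · rintro k hk s' h18 ⟨h2, h3⟩
    have hr := hs.of_frame h2 (by norm_num) (by omega)
    refine Runs.seq (T₁ := 10) (T₂ := 190 * L) (Runs.setF (by simp [NExp.cost, FExp.cost]) ?_)
      (by rw [pow_one]; omega)
    simp only [NExp.eval, FExp.eval, hr.nat10]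
    set s₁ := s'.setFld (D + 2 * L + 2 * (R * R + 1) + 1) 1 with hs₁
    have hf₁ : Frame 19 (D + 2 * L + 2 * (R * R + 1) + 1) s' s₁ := (Frame.refl s').setFld le_rfl _
    refine Runs.seq (T₂ := 35) ((runs_lagrProg (x := x) (c := k)
      (hr.of_frame hf₁ (by norm_num) (by omega)) hK
      ((h2.nat 17 (by norm_num)).trans hx) hxL h18 hk (by simp [hs₁])).mono le_rfl ?_) (by omega)
    rintro s₂ ⟨hf₂, hl⟩
    have hf := hf₁.trans hf₂
    have hr₂ := hr.of_frame hf (by norm_num) (by omega)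
    have h18' : s₂.nat 18 = k := (hf.nat 18 (by norm_num)).trans h18
    refine Runs.setF (by simp [NExp.cost, FExp.cost]) ?_
    simp only [NExp.eval, FExp.eval, hr₂.nat10, hr₂.nat8, h18', hl, add_zero]
    refine ⟨by simpa using h18',
      (h2.trans (hf.mono (by norm_num) (by omega))).setFld le_rfl _, ?_⟩
    rw [State.setFld_fld, if_pos rfl, Finset.sum_range_succ, hf.fld _ (by omega), h3,
      hf.fld _ (by omega), h2.fld _ (by omega), hv k hk]

end Interpolation

/-! ### Computing one point of the hitting set -/

section Points

variable {F : Type*} [Field F] {e : ℕ → F}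

theorem shift_lt {R L b k c : ℕ} (hR : 1 ≤ R) (hK : R * R + 1 ≤ L) (hc : c < R * R + 1) :
    shift R b k c < L := by
  have h1 : c / R ≤ R := by
    refine (Nat.div_le_div_right (Nat.lt_succ_iff.1 hc)).trans ?_
    rw [Nat.mul_div_cancel _ hR]
  have h2 : c % (if b / 2 ^ k % 2 = 0 then 1 else R) < R := by
    split_ifs
    · rw [Nat.mod_one]
      exact hR
    · exact Nat.mod_lt _ hR
  rw [shift]
  nlinarith

/-- Replace the nodes of the curve of one level by those of the next level; the exponent of the seed
stands at address `15`, the modulus of the second summand of `shift` at address `14`. -/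
def mergeProg : Prog :=
  Prog.seq
    (forLoop 16 (reg 5)
      (Prog.seq (assign 17 (NExp.add (reg 15)
          (NExp.add (NExp.div (reg 16) (reg 4)) (NExp.mod (reg 16) (reg 14)))))
        (Prog.seq interpProg
          (Prog.setF (NExp.add (reg 9) (reg 16)) (FExp.load (auxAddr 0))))))
    (forLoop 16 (reg 5)
      (Prog.setF (NExp.add (reg 8) (reg 16)) (FExp.load (NExp.add (reg 9) (reg 16)))))

/-- Each new node depends on all old ones, hence the second array, copied back at the end. The
evaluation points have exponents g + `shift` < 2 L, the length of the table of powers. -/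
theorem runs_mergeProg {D i R L g b k : ℕ} {w : F} {α : ℕ → F} {s : State F}
    (hs : Ready D i R L w s) (hR : 1 ≤ R) (hK : R * R + 1 ≤ L) (hg : s.nat 15 = g) (hgL : g < L)
    (hα : α k = w ^ g) (hm : s.nat 14 = if b / 2 ^ k % 2 = 0 then 1 else R)
    (hv : ∀ c < R * R + 1, s.fld (D + 2 * L + c) = nodes w (R * R + 1) R α b k c) :
    Runs e mergeProg s (1300 * L ^ 3) fun s' => Frame 16 (D + 2 * L) s s' ∧
      ∀ c < R * R + 1, s'.fld (D + 2 * L + c) = nodes w (R * R + 1) R α b (k + 1) c := by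
  have hL2 : L ≤ L ^ 2 := Nat.le_self_pow (by norm_num) L
  have hL3 : L ≤ L ^ 3 := Nat.le_self_pow (by norm_num) L
  refine Runs.seq (T₁ := 1145 * L ^ 3) (T₂ := 95 * L) ((Runs.forLoop (c := 550) (j := 2) (p := 1)
    (L := L) (N := R * R + 1) (fun l s' =>
      Frame 16 (D + 2 * L + (R * R + 1)) s s' ∧
        ∀ c < l, s'.fld (D + 2 * L + (R * R + 1) + c) = nodes w (R * R + 1) R α b (k + 1) c)
    (by omega) (by rw [pow_one]; omega) (by simp [NExp.cost]) ?_ ?_ ?_ ?_).mono le_rfl ?_)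
    (by omega)
  · exact ⟨Frame.refl s, by simp⟩
  · rintro l s' v ⟨h2, h3⟩
    exact ⟨h2.setNat le_rfl v, h3⟩
  · rintro l s' ⟨h2, -⟩
    simp only [NExp.eval, (hs.of_frame h2 (by norm_num) (by omega)).nat5]
  · rintro c hc s' h16 ⟨h2, h3⟩
    have hr := hs.of_frame h2 (by norm_num) (by omega)
    refine Runs.seq (T₁ := 20) (T₂ := 515 * L ^ 2) (Runs.setN (by simp [NExp.cost]) ?_) (by omega)
    have hx : g + shift R b k c < 2 * L := by
      have := shift_lt (b := b) (k := k) hR hK hc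
      omega
    have hval : NExp.eval s' (NExp.add (reg 15) (NExp.add (NExp.div (reg 16) (reg 4))
        (NExp.mod (reg 16) (reg 14)))) = g + shift R b k c := by
      simp only [NExp.eval, h2.nat 15 (by norm_num), h2.nat 14 (by norm_num), h16, hr.nat4, hg, hm]
      rfl
    rw [hval]
    simp only [NExp.eval]
    set s₁ := s'.setNat 17 (g + shift R b k c) with hs₁
    have hf₁ : Frame 17 (D + 2 * L + 2 * (R * R + 1)) s' s₁ := (Frame.refl s').setNat le_rfl _
    refine Runs.seq (T₂ := 11) ((runs_interpProg (x := g + shift R b k c)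
      (v := nodes w (R * R + 1) R α b k) (hr.of_frame hf₁ (by norm_num) (by omega)) hK
      (by simp [hs₁]) hx fun c' hc' => ?_).mono le_rfl ?_) (by omega)
    · rw [hf₁.fld _ (by omega), h2.fld _ (by omega), hv c' hc']
    · rintro s₂ ⟨hf₂, hl⟩
      have hf : Frame 17 (D + 2 * L + 2 * (R * R + 1)) s' s₂ :=
        hf₁.trans (hf₂.mono (by norm_num) le_rfl)
      have hr₂ := hr.of_frame hf (by norm_num) (by omega)
      have h16' : s₂.nat 16 = c := (hf.nat 16 (by norm_num)).trans h16
      refine Runs.setF (by simp [NExp.cost, FExp.cost]) ?_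
      simp only [NExp.eval, FExp.eval, hr₂.nat10, hr₂.nat9, h16', hl, add_zero]
      refine ⟨by simpa using h16',
        (h2.trans (hf.mono (by norm_num) (by omega))).setFld (by omega) _, fun c' hc' => ?_⟩
      rw [State.setFld_fld]
      rcases Nat.lt_succ_iff_lt_or_eq.1 hc' with h | rfl
      · rw [if_neg (by omega), hf.fld _ (by omega), h3 c' h]
      · rw [if_pos rfl, nodes, hα, pow_add]
  · rintro s₁ ⟨hf₁, hU⟩
    have hr₁ := hs.of_frame hf₁ (by norm_num) (by omega)
    refine (Runs.forLoop (c := 25) (j := 0) (p := 1) (L := L) (N := R * R + 1) (fun l s' =>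
        Frame 16 (D + 2 * L) s s' ∧
          (∀ c < R * R + 1, s'.fld (D + 2 * L + (R * R + 1) + c) =
            nodes w (R * R + 1) R α b (k + 1) c) ∧
          ∀ c < l, s'.fld (D + 2 * L + c) = nodes w (R * R + 1) R α b (k + 1) c)
      (by omega) (by rw [pow_one]; omega) (by simp [NExp.cost]) ?_ ?_ ?_ ?_).mono
      (by norm_num) fun s' h => ⟨h.1, h.2.2⟩
    · exact ⟨hf₁.mono le_rfl (by omega), hU, by simp⟩
    · rintro l s' v ⟨h2, h3⟩
      exact ⟨h2.setNat le_rfl v, h3⟩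
    · rintro l s' ⟨h2, -⟩
      simp only [NExp.eval, (hs.of_frame h2 (by norm_num) (by omega)).nat5]
    · rintro c hc s' h16 ⟨h2, h3, h4⟩
      have hr := hs.of_frame h2 (by norm_num) (by omega)
      refine Runs.setF (by simp [NExp.cost, FExp.cost]) ?_
      simp only [NExp.eval, FExp.eval, hr.nat8, hr.nat9, h16, h3 c hc]
      refine ⟨by simpa using h16, h2.setFld (by omega) _, fun c' hc' => ?_, fun c' hc' => ?_⟩
      · rw [State.setFld_fld, if_neg (by omega), h3 c' hc']
      · rw [State.setFld_fld]
        rcases Nat.lt_succ_iff_lt_or_eq.1 hc' with h | rfl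
        · rw [if_neg (by omega), h4 c' h]
        · rw [if_pos rfl]

/-- Write the coordinate whose index stands at address `11`. -/
def coordProg : Prog :=
  Prog.seq (assign 12 (reg 3)) (Prog.seq (assign 13 (NExp.const 1))
    (Prog.seq (forLoop 16 (reg 5)
      (Prog.setF (NExp.add (reg 8) (reg 16)) (FExp.load (powAddr 16))))
    (Prog.seq
      (Prog.loop (Test.le (NExp.add (reg 13) (NExp.const 1)) (reg 0))
        (Prog.seq (assign 15 (NExp.mod (reg 12) (reg 6)))
        (Prog.seq (assign 12 (NExp.div (reg 12) (reg 6)))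
        (Prog.seq (Prog.ite
          (Test.le (NExp.mod (NExp.div (reg 11) (reg 13)) (NExp.const 2)) (NExp.const 0))
          (assign 14 (NExp.const 1)) (assign 14 (reg 4)))
        (Prog.seq mergeProg (assign 13 (NExp.add (reg 13) (reg 13))))))))
    (Prog.seq (assign 17 (NExp.mod (reg 12) (reg 6)))
    (Prog.seq interpProg (Prog.setF (reg 11) (FExp.load (auxAddr 0))))))))

theorem runs_coordProg {D i R L b : ℕ} {w : F} {s : State F} (hs : Ready D i R L w s)
    (hR : 1 ≤ R) (hK : R * R + 1 ≤ L) (hDL : D ≤ L) (hb : s.nat 11 = b) (hbD : b < D) :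
    Runs e coordProg s (2300 * L ^ 4) fun s' => (∀ a < 12, s'.nat a = s.nat a) ∧
      (∀ a < D + 2 * L, a ≠ b → s'.fld a = s.fld a) ∧ s'.fld b = gridPoint w D R L i b := by
  have hL1 : 1 ≤ L := by omega
  have hpow : ∀ j ≤ 4, L ^ j ≤ L ^ 4 := fun j hj => Nat.pow_le_pow_right hL1 hj
  have hp1 := hpow 1 (by norm_num)
  rw [pow_one] at hp1
  have hp2 := hpow 2 (by norm_num)
  have hp0 : 1 ≤ L ^ 3 := Nat.one_le_pow _ _ hL1
  refine Runs.seq (T₁ := 4) (T₂ := 2290 * L ^ 4) (Runs.setN (by simp [NExp.cost]) ?_) (by omega)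
  refine Runs.seq (T₁ := 4) (T₂ := 2280 * L ^ 4) (Runs.setN (by simp [NExp.cost]) ?_) (by omega)
  simp only [NExp.eval, hs.nat3]
  set s₀ := (s.setNat 12 i).setNat 13 1 with hs₀
  have hf₀ : Frame 12 (D + 2 * L) s s₀ := ((Frame.refl s).setNat le_rfl _).setNat (by norm_num) _
  let α : ℕ → F := fun j => w ^ (i / L ^ j % L)
  refine Runs.seq (T₁ := 95 * L) (T₂ := 2180 * L ^ 4) ((Runs.forLoop (c := 25) (j := 0) (p := 1)
    (L := L) (N := R * R + 1) (fun l s' => Frame 12 (D + 2 * L) s s' ∧ s'.nat 12 = i ∧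
      s'.nat 13 = 1 ∧ ∀ c < l, s'.fld (D + 2 * L + c) = w ^ c)
    hL1 (by rw [pow_one]; omega) (by simp [NExp.cost]) ?_ ?_ ?_ ?_).mono (by norm_num) ?_)
    (by omega)
  · exact ⟨hf₀, by simp [hs₀], by simp [hs₀], by simp⟩
  · rintro l s' v ⟨h2, h3, h4, h5⟩
    exact ⟨h2.setNat (by norm_num) v, by simpa using h3, by simpa using h4, h5⟩
  · rintro l s' ⟨h2, -⟩
    simp only [NExp.eval, (hs.of_frame h2 (by norm_num) (by omega)).nat5]
  · rintro c hc s' h16 ⟨h2, h3, h4, h5⟩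
    have hr := hs.of_frame h2 (by norm_num) (by omega)
    refine Runs.setF (by simp [NExp.cost, FExp.cost]) ?_
    simp only [NExp.eval, FExp.eval, hr.nat8, hr.nat0, h16, hr.table c (by omega)]
    refine ⟨by simpa using h16, h2.setFld (by omega) _, by simpa using h3, by simpa using h4,
      fun c' hc' => ?_⟩
    rw [State.setFld_fld]
    rcases Nat.lt_succ_iff_lt_or_eq.1 hc' with h | rfl
    · rw [if_neg (by omega), h5 c' h]
    · rw [if_pos rfl]
  rintro s₁ ⟨hf₁, h12, h13, hV⟩
  have hclog : Nat.clog 2 D ≤ L :=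
    (Nat.clog_le_of_le_pow (Nat.lt_two_pow_self (n := D)).le).trans hDL
  -- Address 12 holds the digits of i not yet consumed and address 13 holds 2^k; the test 2^k < D
  -- succeeds exactly ⌈lg D⌉ times.
  refine Runs.seq (T₁ := L * (1500 * L ^ 3 + 7) + 7) (T₂ := 600 * L ^ 4) ((Runs.loop
    (T := 1500 * L ^ 3) (N := Nat.clog 2 D) (fun k s' => Frame 12 (D + 2 * L) s s' ∧
      s'.nat 12 = i / L ^ k ∧ s'.nat 13 = 2 ^ k ∧
      ∀ c < R * R + 1, s'.fld (D + 2 * L + c) = nodes w (R * R + 1) R α b k c)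
    ?_ ?_ ?_).mono ?_ ?_) ?_
  · exact ⟨hf₁, by simpa using h12, by simpa using h13, hV⟩
  · rintro k hk s' ⟨h2, h3, h4, h5⟩
    have hr := hs.of_frame h2 (by norm_num) (by omega)
    have hkD : 2 ^ k < D := (Nat.lt_clog_iff_pow_lt (by norm_num)).1 hk
    refine ⟨by simp only [Test.Holds, NExp.eval, hr.nat0, h4]; omega, ?_⟩
    refine Runs.seq (T₁ := 7) (T₂ := 1490 * L ^ 3) (Runs.setN (by simp [NExp.cost]) ?_) (by omega)
    refine Runs.seq (T₁ := 7) (T₂ := 1480 * L ^ 3) (Runs.setN (by simp [NExp.cost]) ?_) (by omega)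
    simp only [NExp.eval, State.setNat_nat, hr.nat6, h3]
    norm_num only [if_true, if_false]
    set s₂ := (s'.setNat 15 (i / L ^ k % L)).setNat 12 (i / L ^ k / L) with hs₂
    have hf₂ : Frame 12 (D + 2 * L) s s₂ := (h2.setNat (by norm_num) _).setNat (by norm_num) _
    have hr₂ := hs.of_frame hf₂ (by norm_num) (by omega)
    have h11 : s₂.nat 11 = b := (hf₂.nat 11 (by norm_num)).trans hb
    have h13' : s₂.nat 13 = 2 ^ k := by simpa [hs₂] using h4
    refine Runs.seq (T₁ := 20) (T₂ := 1400 * L ^ 3)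
      (((Runs.ite (T := 8) (Q := fun s₃ => s₃ = s₂.setNat 14 (if b / 2 ^ k % 2 = 0 then 1 else R))
        (fun h => Runs.setN (by simp [NExp.cost]) ?_)
        (fun h => Runs.setN (by simp [NExp.cost]) ?_)
        (by simp [Test.cost, NExp.cost])).mono le_rfl ?_)) (by omega)
    · simp only [Test.Holds, NExp.eval, h11, h13'] at h
      rw [if_pos (by omega)]
      rfl
    · simp only [Test.Holds, NExp.eval, h11, h13'] at h
      rw [if_neg (by omega)]
      simp only [NExp.eval, hr₂.nat4]
    rintro s₃ rfl
    have hf₃ := hf₂.setNat (show 12 ≤ 14 by norm_num) (if b / 2 ^ k % 2 = 0 then 1 else R)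
    set s₃ := s₂.setNat 14 (if b / 2 ^ k % 2 = 0 then 1 else R) with hs₃
    refine Runs.seq (T₂ := 10) ((runs_mergeProg (g := i / L ^ k % L) (b := b) (k := k) (α := α)
      (hs.of_frame hf₃ (by norm_num) (by omega)) hR hK (by simp [hs₃, hs₂])
      (Nat.mod_lt _ hL1) rfl (by simp [hs₃]) (by simpa [hs₃, hs₂] using h5)).mono le_rfl ?_)
      (by omega)
    rintro s₄ ⟨hf₄, h6⟩
    have h13'' : s₄.nat 13 = 2 ^ k := by
      rw [hf₄.nat 13 (by norm_num)]
      simpa [hs₃] using h13'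
    refine Runs.setN (by simp [NExp.cost]) ⟨?_, ?_, ?_, ?_⟩
    · exact (hf₃.trans (hf₄.mono (by norm_num) le_rfl)).setNat (by simp [NExp.eval]) _
    · simp only [NExp.eval, State.setNat_nat, hf₄.nat 12 (by norm_num)]
      simp [hs₃, hs₂, Nat.div_div_eq_div_mul, pow_succ]
    · simp only [NExp.eval, State.setNat_nat, h13'']
      simp only [if_true, pow_succ]
      ring
    · simpa using h6
  · rintro s' ⟨h2, h3, h4, h5⟩
    have hr := hs.of_frame h2 (by norm_num) (by omega)
    have : D ≤ 2 ^ Nat.clog 2 D := Nat.le_pow_clog (by norm_num) D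
    simp only [Test.Holds, NExp.eval, hr.nat0, h4]
    omega
  · simp only [Test.cost, NExp.cost]
    gcongr
  · rintro s₂ ⟨h2, h3, h4, h5⟩
    have hr := hs.of_frame h2 (by norm_num) (by omega)
    refine Runs.seq (T₁ := 7) (T₂ := 550 * L ^ 4) (Runs.setN (by simp [NExp.cost]) ?_) (by omega)
    simp only [NExp.eval, hr.nat6, h3]
    set s₃ := s₂.setNat 17 (i / L ^ Nat.clog 2 D % L) with hs₃
    have hf₃ : Frame 12 (D + 2 * L) s s₃ := h2.setNat (by norm_num) _
    refine Runs.seq (T₂ := 10) ((runs_interpProg (x := i / L ^ Nat.clog 2 D % L)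
      (hs.of_frame hf₃ (by norm_num) (by omega)) hK (by simp [hs₃])
      ((Nat.mod_lt _ hL1).trans_le (by omega)) h5).mono le_rfl ?_) (by omega)
    rintro s₄ ⟨hf₄, h6⟩
    have hf₅ := hf₃.trans (hf₄.mono (by norm_num) (by omega))
    have hr₄ := hs.of_frame hf₅ (by norm_num) (by omega)
    have h11 : s₄.nat 11 = b := (hf₅.nat 11 (by norm_num)).trans hb
    refine Runs.setF (by simp [NExp.cost, FExp.cost]) ?_
    simp only [NExp.eval, FExp.eval, hr₄.nat10, h11, h6, add_zero]
    refine ⟨fun a ha => hf₅.nat a ha, fun a ha hab => ?_, ?_⟩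
    · rw [State.setFld_fld, if_neg hab, hf₅.fld a ha]
    · rw [State.setFld_fld, if_pos rfl]
      rfl
  · have : L * (1500 * L ^ 3 + 7) = 1500 * L ^ 4 + 7 * L := by ring
    omega

/-- Write all coordinates of the point. -/
def pointProg : Prog := forLoop 11 (reg 0) coordProg

theorem runs_pointProg {D i R L : ℕ} {w : F} {s : State F} (hs : Ready D i R L w s)
    (hR : 1 ≤ R) (hK : R * R + 1 ≤ L) (hDL : D ≤ L) :
    Runs e pointProg s (4645 * L ^ 5) fun s' => ∀ b < D, s'.fld b = gridPoint w D R L i b := by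
  refine (Runs.forLoop (c := 2300) (j := 4) (p := 1) (L := L) (N := D) (fun l s' =>
    Ready D i R L w s' ∧ ∀ b < l, s'.fld b = gridPoint w D R L i b)
    (by omega) (by rw [pow_one]; omega) (by simp [NExp.cost]) ⟨hs, by simp⟩ ?_ ?_ ?_).mono
    le_rfl fun s' h => h.2
  · rintro l s' v ⟨h2, h3⟩
    refine ⟨h2.of_frame ((Frame.refl (θ := 11) (φ := D + 2 * L) s').setNat le_rfl v)
      le_rfl le_rfl, h3⟩
  · rintro l s' ⟨h2, -⟩
    simp only [NExp.eval, h2.nat0]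
  · rintro b hb s' h11 ⟨h2, h3⟩
    refine (runs_coordProg h2 hR hK hDL h11 hb).mono le_rfl ?_
    rintro s'' ⟨h4, h5, h6⟩
    refine ⟨(h4 11 (by norm_num)).trans h11,
      h2.of_eq (fun a ha => h4 a (by omega)) (fun a h7 h8 => h5 a h8 (by omega)), fun c hc => ?_⟩
    rcases Nat.lt_succ_iff_lt_or_eq.1 hc with h | rfl
    · rw [h5 c (by omega) (by omega), h3 c h]
    · exact h6

end Points

/-! ### Parameters, search for w, and the table of powers -/

section Setup

variable {F : Type*} [Field F] {e : ℕ → F}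

/-- Write the product of the numbers at the addresses `x` and `y` to address `z`. -/
def mulProg (z x y : ℕ) : Prog :=
  Prog.seq (assign z (NExp.const 0)) (forLoop 12 (reg x) (assign z (NExp.add (reg z) (reg y))))

theorem runs_mulProg {L z x y a b : ℕ} {s : State F} (hL : 1 ≤ L) (hz : z < 12) (hx : x < 12)
    (hy : y < 12) (hxz : x ≠ z) (hyz : y ≠ z) (ha : s.nat x = a) (hb : s.nat y = b)
    (haL : a ≤ L) :
    Runs e (mulProg z x y) s (70 * L) fun s' =>
      s'.nat z = a * b ∧ ∀ c, c ≠ z → c ≠ 12 → s'.nat c = s.nat c := by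
  refine Runs.seq (T₁ := 3) (T₂ := 65 * L) (Runs.setN (by simp [NExp.cost]) ?_) (by omega)
  refine (Runs.forLoop (c := 10) (j := 0) (p := 1) (L := L) (N := a) (fun k s' =>
    s'.nat z = k * b ∧ ∀ c, c ≠ z → c ≠ 12 → s'.nat c = s.nat c) hL (by rw [pow_one]; omega)
    (by simp [NExp.cost]) ?_ ?_ ?_ ?_).mono (by norm_num) fun s' h => h
  · refine ⟨by simp [NExp.eval], fun c hc _ => ?_⟩
    simp [NExp.eval, hc]
  · rintro k s' v ⟨h1, h2⟩
    refine ⟨by rw [State.setNat_nat, if_neg (by omega), h1], fun c hc hc' => ?_⟩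
    rw [State.setNat_nat, if_neg hc', h2 c hc hc']
  · rintro k s' ⟨-, h2⟩
    simp only [NExp.eval, h2 x hxz (by omega), ha]
  · rintro k hk s' h12 ⟨h1, h2⟩
    refine Runs.setN (by simp [NExp.cost]) ?_
    simp only [NExp.eval, h1, h2 y hyz (by omega), hb]
    refine ⟨by rw [State.setNat_nat, if_neg (by omega), h12], ?_, fun c hc hc' => ?_⟩
    · rw [State.setNat_nat, if_pos rfl]
      ring
    · rw [State.setNat_nat, if_neg hc, h2 c hc hc']

/-- Compute the parameters and the base addresses of the arrays. -/
def setupProg : Prog :=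
  Prog.seq (mulProg 4 2 2) (Prog.seq (mulProg 5 4 4) (Prog.seq (mulProg 9 0 1)
  (Prog.seq (mulProg 6 9 5) (Prog.seq (assign 6 (NExp.add (reg 6) (reg 6)))
  (Prog.seq (assign 5 (NExp.add (reg 5) (NExp.const 1))) (Prog.seq (mulProg 7 6 6)
  (Prog.seq (assign 7 (NExp.add (reg 7) (NExp.const 1)))
  (Prog.seq (assign 8 (NExp.add (reg 0) (NExp.add (reg 6) (reg 6))))
  (Prog.seq (assign 9 (NExp.add (reg 8) (reg 5)))
  (assign 10 (NExp.add (reg 9) (reg 5))))))))))))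

/-- The memory of natural numbers after the computation of the parameters. -/
structure Allocated (D i R L : ℕ) (s : State F) : Prop where
  nat0 : s.nat 0 = D
  nat3 : s.nat 3 = i
  nat4 : s.nat 4 = R
  nat5 : s.nat 5 = R * R + 1
  nat6 : s.nat 6 = L
  nat7 : s.nat 7 = L * L + 1
  nat8 : s.nat 8 = D + 2 * L
  nat9 : s.nat 9 = D + 2 * L + (R * R + 1)
  nat10 : s.nat 10 = D + 2 * L + 2 * (R * R + 1)

omit [Field F] in
theorem Allocated.of_eq {D i R L : ℕ} {s s' : State F} (h : Allocated D i R L s)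
    (hn : ∀ a < 11, s'.nat a = s.nat a) : Allocated D i R L s' where
  nat0 := (hn 0 (by norm_num)).trans h.nat0
  nat3 := (hn 3 (by norm_num)).trans h.nat3
  nat4 := (hn 4 (by norm_num)).trans h.nat4
  nat5 := (hn 5 (by norm_num)).trans h.nat5
  nat6 := (hn 6 (by norm_num)).trans h.nat6
  nat7 := (hn 7 (by norm_num)).trans h.nat7
  nat8 := (hn 8 (by norm_num)).trans h.nat8
  nat9 := (hn 9 (by norm_num)).trans h.nat9
  nat10 := (hn 10 (by norm_num)).trans h.nat10

theorem runs_setupProg {D n r i L : ℕ} {s : State F} (h0 : s.nat 0 = D) (h1 : s.nat 1 = n)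
    (h2 : s.nat 2 = r) (h3 : s.nat 3 = i) (hL : L = 2 * D * n * (r * r * (r * r)))
    (hL1 : 1 ≤ L) (hDL : D ≤ L) (hDnL : D * n ≤ L) (hrL : r ≤ L) (hRL : r * r ≤ L) :
    Runs e setupProg s (500 * L) (Allocated D i (r * r) L) := by
  refine Runs.seq (T₁ := 70 * L) (T₂ := 430 * L) ((runs_mulProg hL1 (by norm_num) (by norm_num)
    (by norm_num) (by norm_num) (by norm_num) h2 h2 hrL).mono le_rfl ?_) (by omega)
  rintro s₁ ⟨a4, f₁⟩
  refine Runs.seq (T₁ := 70 * L) (T₂ := 360 * L) ((runs_mulProg hL1 (by norm_num) (by norm_num)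
    (by norm_num) (by norm_num) (by norm_num) a4 a4 hRL).mono le_rfl ?_) (by omega)
  rintro s₂ ⟨a5, f₂⟩
  have b0 : s₂.nat 0 = D := by simp [f₂, f₁, h0]
  have b1 : s₂.nat 1 = n := by simp [f₂, f₁, h1]
  refine Runs.seq (T₁ := 70 * L) (T₂ := 290 * L) ((runs_mulProg hL1 (by norm_num) (by norm_num)
    (by norm_num) (by norm_num) (by norm_num) b0 b1 hDL).mono le_rfl ?_) (by omega)
  rintro s₃ ⟨a9, f₃⟩
  -- Address 5 holds R² and address 9 holds D n until L has been formed; both receive their final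
  -- contents afterwards.
  have b5 : s₃.nat 5 = r * r * (r * r) := by simp [f₃, a5]
  refine Runs.seq (T₁ := 70 * L) (T₂ := 220 * L) ((runs_mulProg hL1 (by norm_num) (by norm_num)
    (by norm_num) (by norm_num) (by norm_num) a9 b5 hDnL).mono le_rfl ?_) (by omega)
  rintro s₄ ⟨a6, f₄⟩
  refine Runs.seq (T₁ := 7) (T₂ := 210 * L) (Runs.setN (by simp [NExp.cost]) ?_) (by omega)
  refine Runs.seq (T₁ := 6) (T₂ := 200 * L) (Runs.setN (by simp [NExp.cost]) ?_) (by omega)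
  simp only [NExp.eval]
  set s₅ := (s₄.setNat 6 (s₄.nat 6 + s₄.nat 6)).setNat 5
    ((s₄.setNat 6 (s₄.nat 6 + s₄.nat 6)).nat 5 + 1) with hs₅
  have c6 : s₅.nat 6 = L := by
    simp [hs₅, a6, hL]
    ring
  refine Runs.seq (T₁ := 70 * L) (T₂ := 130 * L) ((runs_mulProg hL1 (by norm_num) (by norm_num)
    (by norm_num) (by norm_num) (by norm_num) c6 c6 le_rfl).mono le_rfl ?_) (by omega)
  rintro s₆ ⟨a7, f₆⟩
  have d0 : s₆.nat 0 = D := by simp [f₆, hs₅, f₄, f₃, b0]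
  have d3 : s₆.nat 3 = i := by simp [f₆, hs₅, f₄, f₃, f₂, f₁, h3]
  have d4 : s₆.nat 4 = r * r := by simp [f₆, hs₅, f₄, f₃, f₂, a4]
  have d5 : s₆.nat 5 = r * r * (r * r) + 1 := by simp [f₆, hs₅, f₄, f₃, a5]
  have d6 : s₆.nat 6 = L := by simp [f₆, c6]
  refine Runs.seq (T₁ := 6) (T₂ := 120 * L) (Runs.setN (by simp [NExp.cost]) ?_) (by omega)
  refine Runs.seq (T₁ := 10) (T₂ := 110 * L) (Runs.setN (by simp [NExp.cost]) ?_) (by omega)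
  refine Runs.seq (T₁ := 7) (T₂ := 100 * L) (Runs.setN (by simp [NExp.cost]) ?_) (by omega)
  refine Runs.setN (by simp [NExp.cost]; omega) ?_
  constructor <;> simp [NExp.eval, d0, d3, d4, d5, d6, a7] <;> ring

open Classical in
/-- The last of the first `k` elements of the enumeration that is a unit of order at least `L`. -/
noncomputable def pick (e : ℕ → F) (L : ℕ) : ℕ → F
  | 0 => 0
  | k + 1 => if HasOrderGE L (e k) then e k else pick e L k

/-- A good element is only ever overwritten by another good one, so the search needs no early exit.
-/
theorem hasOrderGE_pick {L k N : ℕ} (hk : k < N) (h : HasOrderGE L (e k)) :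
    HasOrderGE L (pick e L N) := by
  induction N with
  | zero => omega
  | succ N ih =>
    rw [pick]
    split_ifs with h'
    · exact h'
    · rcases Nat.lt_succ_iff_lt_or_eq.1 hk with hk | rfl
      · exact ih hk
      · exact absurd h h'

theorem hasOrderGE_one_iff (x : F) : HasOrderGE 1 x ↔ x ≠ 0 :=
  ⟨fun h => h.1, fun h => ⟨h, fun j h1 h2 => by omega⟩⟩

theorem hasOrderGE_succ_iff (x : F) (j : ℕ) :
    HasOrderGE (j + 1 + 1) x ↔ HasOrderGE (j + 1) x ∧ x ^ (j + 1) ≠ 1 := by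
  refine ⟨fun h => ⟨⟨h.1, fun l h1 h2 => h.2 l h1 (by omega)⟩, h.2 _ (by omega) (by omega)⟩,
    fun h => ⟨h.1.1, fun l h1 h2 => ?_⟩⟩
  rcases Nat.lt_succ_iff_lt_or_eq.1 h2 with h3 | rfl
  · exact h.1.2 l h1 h3
  · exact h.2

/-- Decide whether the field element at `auxAddr 1` is a unit of order at least `L`; the answer,
`1` or `0`, goes to address `14`. -/
def orderProg : Prog :=
  Prog.seq (Prog.ite (Test.eq (FExp.load (auxAddr 1)) FExp.zero)
    (assign 14 (NExp.const 0)) (assign 14 (NExp.const 1)))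
  (Prog.seq (Prog.setF (auxAddr 2) FExp.one)
    (forLoop 12 (NExp.sub (reg 6) (NExp.const 1))
      (Prog.seq
        (Prog.setF (auxAddr 2) (FExp.mul (FExp.load (auxAddr 2)) (FExp.load (auxAddr 1))))
        (Prog.ite (Test.eq (FExp.load (auxAddr 2)) FExp.one)
          (assign 14 (NExp.const 0)) Prog.skip))))

open Classical in
theorem runs_orderProg {D i R L : ℕ} {s : State F} (hs : Allocated D i R L s) (hL : 1 ≤ L) :
    Runs e orderProg s (150 * L) fun s' =>
      Frame 12 (D + 2 * L + 2 * (R * R + 1) + 2) s s' ∧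
        s'.nat 14 = if HasOrderGE L (s.fld (D + 2 * L + 2 * (R * R + 1) + 1)) then 1 else 0 := by
  set x := s.fld (D + 2 * L + 2 * (R * R + 1) + 1) with hx
  refine Runs.seq (T₁ := 20) (T₂ := 130 * L) ((Runs.ite (T := 3)
    (Q := fun s' => s' = s.setNat 14 (if x ≠ 0 then 1 else 0))
    (fun h => Runs.setN (by simp [NExp.cost]) ?_) (fun h => Runs.setN (by simp [NExp.cost]) ?_)
    (by simp [Test.cost, FExp.cost, NExp.cost])).mono le_rfl ?_) (by omega)
  · simp only [Test.Holds, FExp.eval, NExp.eval, hs.nat10, ← hx] at h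
    simp [h, NExp.eval]
  · simp only [Test.Holds, FExp.eval, NExp.eval, hs.nat10, ← hx] at h
    simp [h, NExp.eval]
  rintro s₁ rfl
  set s₁ := s.setNat 14 (if x ≠ 0 then 1 else 0) with hs₁
  have hf₁ : Frame 12 (D + 2 * L + 2 * (R * R + 1) + 2) s s₁ :=
    (Frame.refl s).setNat (by norm_num) _
  refine Runs.seq (T₁ := 10) (T₂ := 115 * L)
    (Runs.setF (by simp [NExp.cost, FExp.cost]) ?_) (by omega)
  simp only [NExp.eval, FExp.eval, hf₁.nat 10 (by norm_num), hs.nat10]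
  -- After k rounds the powers up to x^k have been compared with 1, which certifies order at least k
  -- + 1; hence L - 1 rounds.
  refine (Runs.forLoop (c := 35) (j := 0) (p := 1) (L := L) (N := L - 1) (fun k s' =>
      Frame 12 (D + 2 * L + 2 * (R * R + 1) + 2) s s' ∧
        s'.fld (D + 2 * L + 2 * (R * R + 1) + 2) = x ^ k ∧
        s'.nat 14 = if HasOrderGE (k + 1) x then 1 else 0)
    hL (by rw [pow_one]; omega) (by simp [NExp.cost]) ?_ ?_ ?_ ?_).mono (by norm_num) ?_
  · refine ⟨hf₁.setFld le_rfl _, by simp, ?_⟩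
    simp [hs₁, hasOrderGE_one_iff]
  · rintro k s' v ⟨h1, h2, h3⟩
    exact ⟨h1.setNat le_rfl v, h2, by simpa using h3⟩
  · rintro k s' ⟨h1, -⟩
    simp only [NExp.eval, h1.nat 6 (by norm_num), hs.nat6]
  · rintro k hk s' h12 ⟨h1, h2, h3⟩
    have h10 : s'.nat 10 = D + 2 * L + 2 * (R * R + 1) := (h1.nat 10 (by norm_num)).trans hs.nat10
    have hx' := h1.fld (D + 2 * L + 2 * (R * R + 1) + 1) (by omega)
    refine Runs.seq (T₁ := 20) (T₂ := 15) (Runs.setF (by simp [NExp.cost, FExp.cost]) ?_)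
      (by norm_num)
    simp only [NExp.eval, FExp.eval, h10, h2, hx', ← hx]
    refine Runs.ite (T := 3) (fun h => Runs.setN (by simp [NExp.cost]) ?_)
      (fun h => Runs.skip (by norm_num) ?_) (by simp [Test.cost, FExp.cost, NExp.cost])
    · simp only [Test.Holds, FExp.eval, NExp.eval, State.setFld_nat, h10, State.setFld_fld,
        if_true, ← pow_succ] at h
      refine ⟨by simpa [NExp.eval] using h12,
        (h1.setFld le_rfl _).setNat (by simp [NExp.eval]) _, by simp [pow_succ], ?_⟩
      rw [hasOrderGE_succ_iff, if_neg fun h' => h'.2 h]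
      simp [NExp.eval]
    · simp only [Test.Holds, FExp.eval, NExp.eval, State.setFld_nat, h10, State.setFld_fld,
        if_true, ← pow_succ] at h
      refine ⟨by simpa using h12, h1.setFld le_rfl _, by simp [pow_succ], ?_⟩
      simp only [State.setFld_nat, h3, hasOrderGE_succ_iff, ne_eq, h, not_false_eq_true, and_true]
  · rintro s' ⟨h1, -, h3⟩
    rw [Nat.sub_add_cancel hL] at h3
    exact ⟨h1, h3⟩

/-- Search the enumeration for a unit of order at least `L`, to be written to `auxAddr 0`. -/
def searchProg : Prog :=
  Prog.seq (Prog.setF (auxAddr 0) FExp.zero)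
    (forLoop 11 (reg 7)
      (Prog.seq (Prog.enum (auxAddr 1) (reg 11))
        (Prog.seq orderProg
          (Prog.ite (Test.le (NExp.const 1) (reg 14))
            (Prog.setF (auxAddr 0) (FExp.load (auxAddr 1))) Prog.skip))))

theorem runs_searchProg {D i R L : ℕ} {s : State F} (hs : Allocated D i R L s) (hL : 1 ≤ L) :
    Runs e searchProg s (500 * L ^ 4) fun s' => Allocated D i R L s' ∧
      s'.fld (D + 2 * L + 2 * (R * R + 1)) = pick e L (L * L + 1) := by
  classical
  have hL2 : L ≤ L ^ 2 := Nat.le_self_pow (by norm_num) L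
  have hL4 : 1 ≤ L ^ 4 := Nat.one_le_pow _ _ hL
  refine Runs.seq (T₁ := 10) (T₂ := 490 * L ^ 4)
    (Runs.setF (by simp [NExp.cost, FExp.cost]) ?_) (by omega)
  simp only [NExp.eval, FExp.eval, hs.nat10, add_zero]
  refine (Runs.forLoop (c := 200) (j := 2) (p := 2) (L := L) (N := L * L + 1) (fun k s' =>
      Allocated D i R L s' ∧ s'.fld (D + 2 * L + 2 * (R * R + 1)) = pick e L k)
    hL (by nlinarith) (by simp [NExp.cost]) ?_ ?_ ?_ ?_).mono (by norm_num; omega) fun s' h => h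
  · exact ⟨hs.of_eq fun a _ => rfl, by simp [pick]⟩
  · rintro k s' v ⟨h1, h2⟩
    exact ⟨h1.of_eq fun a ha => by rw [State.setNat_nat, if_neg (by omega)], h2⟩
  · rintro k s' ⟨h1, -⟩
    simp only [NExp.eval, h1.nat7]
  · rintro k hk s' h11 ⟨h1, h2⟩
    refine Runs.seq (T₁ := 7 + L ^ 2) (T₂ := 190 * L ^ 2) (Runs.enum ?_ ?_) (by nlinarith)
    · simp only [NExp.cost, NExp.eval, h11]
      rw [pow_two]
      omega
    simp only [NExp.eval, h1.nat10, h11]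
    set s₁ := s'.setFld (D + 2 * L + 2 * (R * R + 1) + 1) (e k) with hs₁
    have ha₁ : Allocated D i R L s₁ := h1.of_eq fun a _ => rfl
    refine Runs.seq (T₁ := 150 * L) (T₂ := 20) ((runs_orderProg ha₁ hL).mono le_rfl ?_)
      (by omega)
    rintro s₂ ⟨hf₂, h14⟩
    have hs₁x : s₁.fld (D + 2 * L + 2 * (R * R + 1) + 1) = e k := by simp [hs₁]
    have ha₂ : Allocated D i R L s₂ := ha₁.of_eq fun a ha => hf₂.nat a (by omega)
    have h11' : s₂.nat 11 = k := (hf₂.nat 11 (by norm_num)).trans (by simpa [hs₁] using h11)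
    rw [hs₁x] at h14
    refine Runs.ite (T := 15) (fun h => Runs.setF (by simp [NExp.cost, FExp.cost]) ?_)
      (fun h => Runs.skip (by norm_num) ?_) (by simp [Test.cost, NExp.cost])
    · simp only [Test.Holds, NExp.eval, h14] at h
      have hg : HasOrderGE L (e k) := by
        by_contra hg
        simp [hg] at h
      simp only [NExp.eval, FExp.eval, ha₂.nat10, add_zero,
        hf₂.fld (D + 2 * L + 2 * (R * R + 1) + 1) (by omega), hs₁x]
      refine ⟨by simpa using h11', ha₂.of_eq fun a _ => rfl, ?_⟩
      rw [State.setFld_fld, if_pos rfl, pick, if_pos hg]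
    · simp only [Test.Holds, NExp.eval, h14] at h
      have hg : ¬ HasOrderGE L (e k) := fun hg => by simp [hg] at h
      refine ⟨h11', ha₂, ?_⟩
      rw [pick, if_neg hg, ← h2, hf₂.fld _ (by omega)]
      simp [hs₁]

/-- Fill the table of the powers of the field element at `auxAddr 0`. -/
def tableProg : Prog :=
  Prog.seq (Prog.setF (auxAddr 1) FExp.one)
    (forLoop 11 (NExp.add (reg 6) (reg 6))
      (Prog.seq (Prog.setF (powAddr 11) (FExp.load (auxAddr 1)))
        (Prog.setF (auxAddr 1) (FExp.mul (FExp.load (auxAddr 1)) (FExp.load (auxAddr 0))))))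

theorem runs_tableProg {D i R L : ℕ} {w : F} {s : State F} (hs : Allocated D i R L s) (hL : 1 ≤ L)
    (hw : s.fld (D + 2 * L + 2 * (R * R + 1)) = w) :
    Runs e tableProg s (150 * L) (Ready D i R L w) := by
  refine Runs.seq (T₁ := 10) (T₂ := 125 * L)
    (Runs.setF (by simp [NExp.cost, FExp.cost]) ?_) (by omega)
  simp only [NExp.eval, FExp.eval, hs.nat10]
  refine (Runs.forLoop (c := 40) (j := 0) (p := 1) (L := L) (N := L + L) (fun k s' =>
      Allocated D i R L s' ∧ s'.fld (D + 2 * L + 2 * (R * R + 1)) = w ∧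
        s'.fld (D + 2 * L + 2 * (R * R + 1) + 1) = w ^ k ∧ ∀ j < k, s'.fld (D + j) = w ^ j)
    hL (by rw [pow_one]; omega) (by simp [NExp.cost]) ?_ ?_ ?_ ?_).mono (by norm_num) ?_
  · exact ⟨hs.of_eq fun a _ => rfl, by simpa using hw, by simp, by simp⟩
  · rintro k s' v ⟨h1, h2⟩
    exact ⟨h1.of_eq fun a ha => by rw [State.setNat_nat, if_neg (by omega)], h2⟩
  · rintro k s' ⟨h1, -⟩
    simp only [NExp.eval, h1.nat6]
  · rintro k hk s' h11 ⟨h1, h2, h3, h4⟩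
    refine Runs.seq (T₁ := 15) (T₂ := 20) (Runs.setF (by simp [NExp.cost, FExp.cost]) ?_)
      (by norm_num)
    refine Runs.setF (by simp [NExp.cost, FExp.cost]) ?_
    simp only [NExp.eval, FExp.eval, State.setFld_nat, h1.nat0, h1.nat10, h11, h3, add_zero]
    refine ⟨by simp, h1.of_eq fun a _ => rfl, ?_, ?_, fun j hj => ?_⟩
    · rw [State.setFld_fld, if_neg (by omega), State.setFld_fld, if_neg (by omega), h2]
    · rw [State.setFld_fld, if_pos rfl, State.setFld_fld, if_neg (by omega), State.setFld_fld,
        if_neg (by omega), h3, h2, pow_succ]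
    · rw [State.setFld_fld, if_neg (by omega), State.setFld_fld]
      rcases Nat.lt_succ_iff_lt_or_eq.1 hj with h | rfl
      · rw [if_neg (by omega), h4 j h]
      · rw [if_pos rfl]
  · rintro s' ⟨h1, -, -, h4⟩
    exact ⟨h1.nat0, h1.nat3, h1.nat4, h1.nat5, h1.nat6, h1.nat8, h1.nat9, h1.nat10,
      fun j hj => h4 j (by omega)⟩

/-- The program that computes the points of the hitting set. -/
def hittingSetProg : Prog :=
  Prog.seq setupProg (Prog.seq searchProg (Prog.seq tableProg pointProg))

/-- Nothing is assumed about the enumeration: the program evaluates the formula of the grid points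
for whatever w the search returns. The order of w matters only for the hitting property. -/
theorem runs_hittingSetProg {D n r L : ℕ} (hD : 1 ≤ D) (hn : 1 ≤ n) (hr : 1 ≤ r)
    (hL : L = 2 * D * n * (r * r * (r * r))) (i : ℕ) :
    Runs e hittingSetProg (input F D n r i) (6000 * L ^ 5) fun s' =>
      ∀ b < D, s'.fld b = gridPoint (pick e L (L * L + 1)) D (r * r) L i b := by
  have hDn : 1 ≤ D * n := Nat.mul_pos hD hn
  have hR : 1 ≤ r * r := Nat.mul_pos hr hr
  have hRR : r * r ≤ r * r * (r * r) := Nat.le_mul_of_pos_left _ hR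
  have hrR : r ≤ r * r := Nat.le_mul_of_pos_left _ hr
  have hLe : L = 2 * (D * n * (r * r * (r * r))) := by rw [hL]; ring
  have h1 : D * n ≤ D * n * (r * r * (r * r)) := Nat.le_mul_of_pos_right _ (by omega)
  have h2 : r * r * (r * r) ≤ D * n * (r * r * (r * r)) := Nat.le_mul_of_pos_left _ hDn
  have h3 : D ≤ D * n := Nat.le_mul_of_pos_right _ hn
  have hL1 : 1 ≤ L := by omega
  have hp1 : L ≤ L ^ 5 := Nat.le_self_pow (by norm_num) L
  have hp4 : L ^ 4 ≤ L ^ 5 := Nat.pow_le_pow_right hL1 (by norm_num)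
  refine Runs.seq (T₂ := 5400 * L ^ 5) ((runs_setupProg (D := D) (n := n) (r := r) (i := i)
    (by simp [input]) (by simp [input]) (by simp [input]) (by simp [input]) hL hL1 (by omega)
    (by omega) (by omega) (by omega)).mono le_rfl ?_) (by omega)
  intro s₁ hs₁
  refine Runs.seq (T₂ := 4900 * L ^ 5) ((runs_searchProg hs₁ hL1).mono le_rfl ?_) (by omega)
  rintro s₂ ⟨hs₂, hw⟩
  exact Runs.seq ((runs_tableProg hs₂ hL1 hw).mono le_rfl fun s₃ hs₃ =>
    runs_pointProg hs₃ hR (by omega) (by omega)) (by omega)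

theorem mul_pow_five_le_mul_pow {D n r L : ℕ} (hL : L = 2 * D * n * (r * r * (r * r))) :
    6000 * L ^ 5 ≤ 192000 * (D + n + r) ^ 30 := by
  have hLZ : L ≤ 2 * (D + n + r) ^ 6 := by
    rw [hL]
    calc 2 * D * n * (r * r * (r * r))
        ≤ 2 * (D + n + r) * (D + n + r) *
          ((D + n + r) * (D + n + r) * ((D + n + r) * (D + n + r))) := by gcongr <;> omega
      _ = 2 * (D + n + r) ^ 6 := by ring
  generalize D + n + r = Z at hLZ
  calc 6000 * L ^ 5 ≤ 6000 * (2 * Z ^ 6) ^ 5 := by gcongr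
    _ = 192000 * Z ^ 30 := by ring

theorem computesPoint_gridPoint {D n r L : ℕ} (hD : 1 ≤ D) (hn : 1 ≤ n) (hr : 1 ≤ r)
    (hL : L = 2 * D * n * (r * r * (r * r))) (i : ℕ) :
    ComputesPoint e hittingSetProg D n r i (192000 * (D + n + r) ^ 30) fun b : Fin D =>
      gridPoint (pick e L (L * L + 1)) D (r * r) L i b := by
  obtain ⟨t, s, ht, hex, hs⟩ := runs_hittingSetProg (e := e) hD hn hr hL i
  exact ⟨t, s, ht.trans (mul_pow_five_le_mul_pow hL), hex, fun b => hs b b.2⟩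

end Setup

end ROPIT

/-! ### The main theorem -/

theorem mainTheorem1 :
    ∃ (P : ROPIT.Prog) (c k : ℕ),
      ∀ (F : Type*) [Field F] (e : ℕ → F), ROPIT.IsEnumeration e →
      ∀ D n r : ℕ, 1 ≤ D → 1 ≤ n → 1 ≤ r →
        (((2 * D * n * r ^ 3) ^ 2 : ℕ) : ℕ∞) ≤ ENat.card F →
        ∃ (N : ℕ) (h : Fin N → Fin D → F),
          N ≤ (2 * D * n ^ 2 * r ^ 4) ^ (Nat.clog 2 D + 1) ∧
          ROPIT.IsHittingSet (ROPIT.roabpClass F D n r) (Set.range h) ∧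
          ∀ i : Fin N,
            ROPIT.ComputesPoint e P D n r (i : ℕ) (c * (D + n + r) ^ k) (h i) := by
  refine ⟨ROPIT.hittingSetProg, 192000, 30, fun F _ e he D n r hD hn hr hF => ?_⟩
  obtain ⟨L, hL⟩ : ∃ L, L = 2 * D * n * (r * r * (r * r)) := ⟨_, rfl⟩
  have hDn : 1 ≤ D * n := Nat.mul_pos hD hn
  have hR : 1 ≤ r * r := Nat.mul_pos hr hr
  have hL1 : 1 ≤ L := by
    rw [hL]
    exact Nat.one_le_iff_ne_zero.2 (by positivity)
  -- The field is larger than L, which provides a generator of order at least L when the field is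
  -- small.
  have hlt : L < (2 * D * n * r ^ 3) ^ 2 := by
    have h1 : (2 * D * n * r ^ 3) ^ 2 = L * (2 * (D * n * (r * r))) := by
      rw [hL]
      ring
    have h2 : 1 ≤ D * n * (r * r) := Nat.mul_pos hDn hR
    rw [h1]
    nlinarith
  obtain ⟨k, hk, hgood⟩ := ROPIT.exists_hasOrderGE he hL1
    (lt_of_lt_of_le (by exact_mod_cast hlt) hF)
  refine ⟨L ^ (Nat.clog 2 D + 1), fun i b =>
    ROPIT.gridPoint (ROPIT.pick e L (L * L + 1)) D (r * r) L i b, ?_, ?_, fun i =>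
    ROPIT.computesPoint_gridPoint hD hn hr hL i⟩
  -- The construction has only 2 D n r⁴ values per digit; the stated bound has n² in place of n.
  · refine Nat.pow_le_pow_left ?_ _
    rw [hL]
    calc 2 * D * n * (r * r * (r * r)) = 2 * D * n * 1 * r ^ 4 := by ring
      _ ≤ 2 * D * n * n * r ^ 4 := by gcongr
      _ = 2 * D * n ^ 2 * r ^ 4 := by ring
  · exact ROPIT.isHittingSet_gridPoint hD hn hr hL (ROPIT.hasOrderGE_pick hk hgood).injOn
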